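/- Let $k$ be an algebraically closed field of characteristic zero. For a finite graph $\Gamma$ (loops and parallel edges allowed) with edge set $\mathcal E$, $|\mathcal E|=n$, let $\Psi_\Gamma=\sum_T\prod_{g\notin T}t_g\in k[t_g : g\in \mathcal E]$, where $T$ ranges over the maximal spanning forests of $\Gamma$, and let $X_\Gamma\subseteq\mathbb P^{n-1}_k$ be the hypersurface $\Psi_\Gamma=0$. Let $\Gamma\smallsetminus e$ and $\Gamma/e$ denote the deletion and the contraction of an edge $e$. A graph is called disjoinable if it is the union of two graphs, neither of which is a forest, that have exactly one vertex and no edge in common. For an edge $e$ of $\Gamma$, consider the following conditions. (I) $\Psi_{\Gamma/e}$ belongs to the ideal of $k[t_g : g\in\mathcal E,\ g\neq e]$ generated by the partial derivatives of $\Psi_{\Gamma\smallsetminus e}$. (II) Let $p\in\mathbb P^{n-1}$ be the point at which all coordinates except $t_e$ vanish, let $\widetilde X_\Gamma$ be the blow-up of $X_\Gamma$ at $p$ (realized as a hypersurface in the blow-up of $\mathbb P^{n-1}$ at $p$), let $E$ be its exceptional divisor, and let $\partial\widetilde X_\Gamma$ be the singularity subscheme of $\widetilde X_\Gamma$, defined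 by the partial derivatives of local equations of $\widetilde X_\Gamma$. For every closed point $q\in E\cap\partial\widetilde X_\Gamma$, if $I\subseteq\mathcal O_{\widetilde X_\Gamma,q}$ denotes the ideal of $\partial\widetilde X_\Gamma$ at $q$ and $u\in\mathcal O_{\widetilde X_\Gamma,q}$ is a local equation of $E$, then $u$ is a non-zero-divisor modulo $I^j$ for all $j\gg0$. Claim. Let $\Gamma$ be a finite graph such that $X_\Gamma$ is nonsingular in codimension $1$ (that is, its local rings at all points of codimension at most $1$ are regular), and let $e$ be an edge of $\Gamma$ such that $\Gamma\smallsetminus e$ is disjoinable. Then at least one of conditions (I) and (II) fails for $(\Gamma,e)$. -/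

import Mathlib

/-! Graph hypersurfaces of finite multigraphs, and the two conditions on a pair `(Γ, e)`.
A multigraph is Mathlib's `Graph α β` (loops and parallel edges are allowed, `α` contains the
vertices, `β` contains the edges). -/

namespace GraphHypersurface

section Graphs

variable {α β : Type*}

/-- A forest: every edge is a bridge, that is, the ends of an edge `g` are not joined by a path
once `g` is removed. In particular there are no loops. -/
def IsForest (G : Graph α β) : Prop :=
  ∀ (g : β) (x y : α), G.IsLink g x y → ¬ Relation.ReflTransGen (G.deleteEdges {g}).Adj x y

/-- `T` is the edge set of a maximal spanning forest of `G`. -/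
def IsMaxSpanningForest (G : Graph α β) (T : Set β) : Prop :=
  Maximal (fun S : Set β => S ⊆ G.edgeSet ∧ IsForest (G.restrict S)) T

/-- The deletion `G ∖ e`. -/
def deletion (G : Graph α β) (e : β) : Graph α β :=
  G.deleteEdges {e}

/-- The contraction `G / e`: the edge `e` is removed and its ends are identified. The vertices of
`G / e` are the classes of vertices of `G` under this identification. -/
def contraction (G : Graph α β) (e : β) : Graph (Set α) β :=
  (G.deleteEdges {e}).map (fun z => {w | w = z ∨ (G.Inc e z ∧ G.Inc e w)})

/-- `G` is obtained by joining at one vertex two graphs, neither of which is a forest. -/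
def IsDisjoinable (G : Graph α β) : Prop :=
  ∃ (G₁ G₂ : Graph α β) (v : α), G₁ ≤ G ∧ G₂ ≤ G ∧
    G₁.vertexSet ∪ G₂.vertexSet = G.vertexSet ∧ G₁.vertexSet ∩ G₂.vertexSet = {v} ∧
    G₁.edgeSet ∪ G₂.edgeSet = G.edgeSet ∧ G₁.edgeSet ∩ G₂.edgeSet = ∅ ∧
    ¬ IsForest G₁ ∧ ¬ IsForest G₂

end Graphs

noncomputable section

open MvPolynomial

variable {α β : Type*} (k : Type*) [Field k]

/-- The graph polynomial `Ψ_G = ∑_T ∏_{g ∉ T} t_g`, where `T` ranges over the maximal spanning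
forests of `G` (for `G` with finitely many edges). Only the variables `t_g` with `g` an edge of
`G` occur in it. -/
def graphPoly (G : Graph α β) : MvPolynomial β k :=
  ∑ᶠ (T : Set β) (_ : IsMaxSpanningForest G T), ∏ᶠ (g : β) (_ : g ∈ G.edgeSet \ T), X g

/-- The equation of the projective hypersurface `X_G` in the standard affine chart `t_f = 1`, with
coordinates indexed by the edges of `G` other than `f`. (The value assigned to variables that are
not edges of `G` is immaterial, as these do not occur in `Ψ_G`.) -/
def chartEquation (G : Graph α β) (f : β) : MvPolynomial ↥(G.edgeSet \ {f}) k :=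
  open Classical in
  aeval (fun g : β => if h : g ∈ G.edgeSet \ {f} then
    (X ⟨g, h⟩ : MvPolynomial ↥(G.edgeSet \ {f}) k) else 1) (graphPoly k G)

/-- The coordinate ring of the intersection of `X_G` with the chart `t_f = 1`. -/
abbrev ChartRing (G : Graph α β) (f : β) : Type _ :=
  MvPolynomial ↥(G.edgeSet \ {f}) k ⧸ Ideal.span {chartEquation k G f}

/-- `X_G` is nonsingular in codimension `1`: the local ring of `X_G` at each point of codimension
at most `1` is regular. The charts `t_f = 1`, with `f` an edge of `G`, cover the projective space
that contains `X_G`. -/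
def NonsingularInCodimOne (G : Graph α β) : Prop :=
  ∀ f ∈ G.edgeSet, ∀ (P : Ideal (ChartRing k G f)) [P.IsPrime], P.height ≤ 1 →
    IsRegularLocalRing (Localization.AtPrime P)

/-- Condition I: `Ψ_{G/e}` belongs to the ideal of partial derivatives of `Ψ_{G∖e}`, in the
polynomial ring in the variables `t_g`, `g` an edge of `G` other than `e`. (The map `killCompl`
only views a polynomial in these variables as an element of that ring.) -/
def ConditionI (G : Graph α β) (e : β) : Prop :=
  killCompl (Subtype.val_injective (p := (· ∈ G.edgeSet \ {e}))) (graphPoly k (contraction G e)) ∈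
    Ideal.span (Set.range fun i : ↥(G.edgeSet \ {e}) =>
      pderiv i (killCompl (Subtype.val_injective (p := (· ∈ G.edgeSet \ {e})))
        (graphPoly k (deletion G e))))

/-- Let `p` be the point of projective space at which all variables but `t_e` vanish. The blow-up
at `p` of the chart `t_e = 1` is covered by affine spaces indexed by the edges `f ≠ e`; in the one
of index `f`, with coordinates `u_g` for `g ≠ e`, the blow-up map is `t_f = u_f`,
`t_g = u_f * u_g` for `g ≠ f`, and the exceptional divisor `D` is `u_f = 0`. This is the pull-back
of the equation `Ψ_G` of `X_G` to that affine space. -/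
def blowupPullback (G : Graph α β) (e : β) (f : ↥(G.edgeSet \ {e})) :
    MvPolynomial ↥(G.edgeSet \ {e}) k :=
  open Classical in
  aeval (fun g : β => if h : g ∈ G.edgeSet \ {e} then
    (if g = f then X f else X f * X ⟨g, h⟩ : MvPolynomial ↥(G.edgeSet \ {e}) k) else 1)
    (graphPoly k G)

/-- The ideal of the blow-up of `X_G` at `p`, in the chart of index `f` of the blow-up of
projective space at `p`: it defines the closure of the inverse image of `X_G ∖ p`, so it is
the saturation of the pulled back ideal of `X_G` by the equation `u_f` of the exceptional
divisor. -/
def blowupIdeal (G : Graph α β) (e : β) (f : ↥(G.edgeSet \ {e})) :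
    Ideal (MvPolynomial ↥(G.edgeSet \ {e}) k) where
  carrier := {q | ∃ N : ℕ, X f ^ N * q ∈ Ideal.span {blowupPullback k G e f}}
  zero_mem' := ⟨0, by simp⟩
  add_mem' := by
    rintro a b ⟨M, hM⟩ ⟨N, hN⟩
    refine ⟨M + N, ?_⟩
    have h := Ideal.add_mem _ (Ideal.mul_mem_left _ (X f ^ N) hM)
      (Ideal.mul_mem_left _ (X f ^ M) hN)
    convert h using 1
    ring
  smul_mem' := by
    rintro c a ⟨N, hN⟩
    refine ⟨N, ?_⟩
    have h := Ideal.mul_mem_left _ c hN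
    convert h using 1
    simp only [smul_eq_mul]
    ring

/-- The coordinate ring of the blow-up of `X_G` at `p`, in the chart of index `f`. -/
abbrev BlowupRing (G : Graph α β) (e : β) (f : ↥(G.edgeSet \ {e})) : Type _ :=
  MvPolynomial ↥(G.edgeSet \ {e}) k ⧸ blowupIdeal k G e f

/-- The equation `u` of the exceptional divisor `E` in the blow-up of `X_G` at `p`. -/
def exceptionalEq (G : Graph α β) (e : β) (f : ↥(G.edgeSet \ {e})) : BlowupRing k G e f :=
  Ideal.Quotient.mk _ (X f)

variable {k} in
/-- The ideal of the singularity subscheme of the affine hypersurface with ideal `K`, in the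
coordinate ring of the hypersurface: it is generated by the partial derivatives of the equations
of the hypersurface. -/
def singularityIdeal {σ : Type*} (K : Ideal (MvPolynomial σ k)) : Ideal (MvPolynomial σ k ⧸ K) :=
  Ideal.span {x | ∃ h ∈ K, ∃ i : σ, x = Ideal.Quotient.mk K (pderiv i h)}

/-- The ideal of the singularity subscheme in the local ring, at the point `q`, of the blow-up of
`X_G` at `p`. -/
def localSingularityIdeal (G : Graph α β) (e : β) (f : ↥(G.edgeSet \ {e}))
    (q : Ideal (BlowupRing k G e f)) [q.IsPrime] : Ideal (Localization.AtPrime q) :=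
  (singularityIdeal (blowupIdeal k G e f)).map
    (algebraMap (BlowupRing k G e f) (Localization.AtPrime q))

/-- Condition II: at every (closed) point `q` of the intersection of the exceptional divisor `E`
with the singularity subscheme of the blow-up of `X_G` at `p`, the equation `u` of `E` is a
non-zero-divisor modulo `I ^ j` for all `j ≫ 0`, where `I` is the ideal of the singularity
subscheme in the local ring of the blow-up at `q`. -/
def ConditionII (G : Graph α β) (e : β) : Prop :=
  ∀ (f : ↥(G.edgeSet \ {e})) (q : Ideal (BlowupRing k G e f)) [q.IsMaximal],
    exceptionalEq k G e f ∈ q → singularityIdeal (blowupIdeal k G e f) ≤ q →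
    ∃ N : ℕ, ∀ j ≥ N, ∀ y : Localization.AtPrime q,
      algebraMap (BlowupRing k G e f) (Localization.AtPrime q) (exceptionalEq k G e f) * y ∈
          localSingularityIdeal k G e f q ^ j →
        y ∈ localSingularityIdeal k G e f q ^ j

end

end GraphHypersurface

/-! Why the claim holds: `F = Ψ_{Γ∖e}` is a product `F₁ * F₂` of nonconstant polynomials in disjoint
sets of variables, because `Γ ∖ e` is disjoinable.

If `e` is a loop or a bridge, `Ψ_Γ` is `t_e * F` or `F`, and `X_Γ` is singular in codimension one
along `F₁ = F₂ = 0` (`exists_prime_not_isRegularLocalRing_of_mul`).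

Otherwise `Ψ_Γ = t_e * F + G` with `G = Ψ_{Γ/e}`. Near the exceptional divisor `u = 0`, the
blow-up at `p` is the hypersurface `F + u * G = 0`, with `F` and `G` dehomogenized. Condition I
places `G` in the ideal `(F₁, F₂)`, hence the whole locus `F₁ = F₂ = u = 0`, which has codimension
at most `3` in the ambient space, lies in the singularity subscheme. It is nonempty: `F₁` and `F₂`
have a common zero with `t_f = 1` for each edge `f` of a maximal forest of `Γ ∖ e`
(`exists_eval_configPoly_eq_zero`). Condition II forbids a component of the singularity subscheme
through a point of this locus to be contained in `u = 0` (`notMem_minimalPrimes_of_pow_cancel`). A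
component that meets this locus has therefore codimension at most `2` in the ambient space and is
generically off the exceptional divisor, where the blow-up is isomorphic to `X_Γ`. So it gives a
point of codimension at most `1` of `X_Γ` at which all partial derivatives of the equation vanish.
In characteristic zero the equation then lies in the square of the maximal ideal
(`exists_mul_mem_sq_of_pderiv_mem`), and `X_Γ` is not regular at that point
(`not_isRegularLocalRing_of_mul_mem_sq`). These steps make up
`exists_prime_not_isRegularLocalRing_of_pow_cancel`.

The facts on graph polynomials come from linear algebra: attaching to an edge the sum of its ends
in the vector space over `ℤ/2` with the vertices as basis, forests become linearly independent
sets (`isForest_iff_linearIndepOn`), contraction becomes projection from a vector, and two graphs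
with one common vertex span independent subspaces. -/

open MvPolynomial

namespace GraphHypersurface

/-! ### Singular points of hypersurfaces -/

theorem height_map_quotient_add_one_le {R : Type*} [CommRing R] [IsDomain R] [IsNoetherianRing R]
    {h : R} (h0 : h ≠ 0) (p : Ideal (R ⧸ Ideal.span {h})) [p.IsPrime] :
    p.height + 1 ≤ (p.comap (Ideal.Quotient.mk (Ideal.span {h}))).height := by
  obtain ⟨s, hs, hl⟩ := Ideal.exists_ltSeries_length_eq_height p
  have hmono : StrictMono (PrimeSpectrum.comap (Ideal.Quotient.mk (Ideal.span {h}))) := by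
    refine Monotone.strictMono_of_injective (fun _ _ hab => Ideal.comap_mono hab) ?_
    exact PrimeSpectrum.comap_injective_of_surjective _ Ideal.Quotient.mk_surjective
  have hbot : (⟨⊥, Ideal.isPrime_bot⟩ : PrimeSpectrum R) < (s.map _ hmono).head := by
    refine lt_of_le_of_ne bot_le fun hc => h0 ?_
    have : h ∈ (PrimeSpectrum.comap (Ideal.Quotient.mk (Ideal.span {h})) s.head).asIdeal := by
      rw [PrimeSpectrum.comap_asIdeal, Ideal.mem_comap,
        Ideal.Quotient.eq_zero_iff_mem.2 (Ideal.mem_span_singleton_self h)]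
      exact zero_mem _
    rw [LTSeries.head_map] at hc
    rw [← hc] at this
    simpa using this
  have := Order.length_le_height_last (p := (s.map _ hmono).cons _ hbot)
  rw [← PrimeSpectrum.height_eq_orderHeight] at this
  rw [← hl]
  have h2 : ((s.map _ hmono).cons _ hbot).last =
     ⟨p.comap (Ideal.Quotient.mk (Ideal.span {h})), inferInstance⟩ := by
    rw [RelSeries.last_cons, LTSeries.last_map, hs]
    rfl
  rw [h2] at this
  simpa using this

/-- If `h` lies in the square of the maximal ideal of `R_P`, then killing `h` lowers the dimension
but not the number of generators of the maximal ideal, so `(R / h)_P` is not regular. The condition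
on `h` is expressed by the membership `s * h ∈ P ^ 2` with `s ∉ P`. -/
theorem not_isRegularLocalRing_of_mul_mem_sq {R : Type*} [CommRing R] [IsDomain R]
    [IsNoetherianRing R] {h : R} (h0 : h ≠ 0) (p : Ideal (R ⧸ Ideal.span {h})) [p.IsPrime] {s : R}
    (hs : Ideal.Quotient.mk _ s ∉ p)
    (hsh : s * h ∈ (p.comap (Ideal.Quotient.mk (Ideal.span {h}))) ^ 2) :
    ¬ IsRegularLocalRing (Localization.AtPrime p) := by
  intro hreg
  set P := p.comap (Ideal.Quotient.mk (Ideal.span {h})) with hP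
  let ψ := Localization.localRingHom P p (Ideal.Quotient.mk (Ideal.span {h})) hP
  have hψ : Function.Surjective ψ :=
    RingHom.surjective_localRingHom_of_surjective _ Ideal.Quotient.mk_surjective p
  have hψl : IsLocalHom ψ := Localization.isLocalHom_localRingHom _ _ _ _
  set m := IsLocalRing.maximalIdeal (Localization.AtPrime P)
  set n := IsLocalRing.maximalIdeal (Localization.AtPrime p)
  have hfg : n.FG := IsNoetherian.noetherian n
  obtain ⟨t, htc, ht⟩ := Submodule.FG.exists_span_finset_card_eq_spanFinrank hfg
  have hmP : m = P.map (algebraMap R (Localization.AtPrime P)) :=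
    (Localization.AtPrime.map_eq_maximalIdeal).symm
  have hh : algebraMap R (Localization.AtPrime P) h ∈ m ^ 2 := by
    have h1 : algebraMap R (Localization.AtPrime P) (s * h) ∈ m ^ 2 := by
      rw [hmP, ← Ideal.map_pow]; exact Ideal.mem_map_of_mem _ hsh
    rw [map_mul] at h1
    exact (Ideal.unit_mul_mem_iff_mem _
      (IsLocalization.map_units (M := P.primeCompl) _ ⟨s, hs⟩)).1 h1
  classical
  choose g hg using hψ
  -- the kernel of `R_P → (R / h)_p` is generated by `h`
  have hker : ∀ x, ψ x = 0 → x ∈ m ^ 2 := by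
    intro x hx
    obtain ⟨a, b, rfl⟩ := IsLocalization.exists_mk'_eq P.primeCompl x
    have h2 : ψ (IsLocalization.mk' _ a b) =
      IsLocalization.mk' (Localization.AtPrime p) (Ideal.Quotient.mk (Ideal.span {h}) a)
       ⟨Ideal.Quotient.mk (Ideal.span {h}) b, b.2⟩ :=
      Localization.localRingHom_mk' _ _ _ _ _ _
    rw [h2, IsLocalization.mk'_eq_zero_iff] at hx
    obtain ⟨⟨c, hc⟩, hca⟩ := hx
    obtain ⟨c, rfl⟩ := Ideal.Quotient.mk_surjective c
    rw [← map_mul, Ideal.Quotient.eq_zero_iff_mem, Ideal.mem_span_singleton] at hca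
    obtain ⟨d, hd⟩ := hca
    have h3 : algebraMap R (Localization.AtPrime P) c *
        algebraMap R (Localization.AtPrime P) a ∈ m ^ 2 := by
      rw [← map_mul, hd, map_mul]
      exact Ideal.mul_mem_right _ _ hh
    have h4 := (Ideal.unit_mul_mem_iff_mem _
      (IsLocalization.map_units (M := P.primeCompl) _ ⟨c, hc⟩)).1 h3
    rw [IsLocalization.mk'_eq_mul_mk'_one]
    exact Ideal.mul_mem_right _ _ h4
  have hgm : ∀ y ∈ n, g y ∈ m := fun y hy => by
    rw [IsLocalRing.mem_maximalIdeal, mem_nonunits_iff] at hy ⊢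
    intro hu; apply hy; rw [← hg y]; exact hu.map ψ
  -- lifts of generators of the maximal ideal of the quotient generate that of `R_P`
  have hle : m ≤ Ideal.span (t.image g : Set _) := by
    have hsm : m ≤ Ideal.span (t.image g : Set _) ⊔ m • m := by
      intro x hx
      have hx' : ψ x ∈ n := by
        rw [IsLocalRing.mem_maximalIdeal, mem_nonunits_iff] at hx ⊢
        exact fun hu => hx (isUnit_of_map_unit ψ x hu)
      rw [← ht] at hx'
      have h5 : ψ x ∈ (Ideal.span (t.image g : Set (Localization.AtPrime P))).map ψ := by
        rw [Ideal.map_span]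
        convert hx'
        ext y
        simp [hg]
      obtain ⟨y, hy, hyx⟩ := (Ideal.mem_map_iff_of_surjective ψ (fun y => ⟨g y, hg y⟩)).1 h5
      have h6 := hker (x - y) (by rw [map_sub, hyx, sub_self])
      rw [sq] at h6
      have : x = y + (x - y) := by ring
      rw [this]
      exact Submodule.add_mem_sup hy h6
    -- Nakayama's lemma
    exact Submodule.le_of_le_smul_of_le_jacobson_bot (IsNoetherian.noetherian m)
      (IsLocalRing.maximalIdeal_le_jacobson _) hsm
  have hm : m = Ideal.span (t.image g : Set _) := by
    refine le_antisymm hle (Ideal.span_le.2 ?_)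
    intro x hx
    simp only [Finset.coe_image, Set.mem_image] at hx
    obtain ⟨y, hy, rfl⟩ := hx
    exact hgm y (by rw [← ht]; exact Submodule.subset_span hy)
  have h7 : P.height ≤ t.card := by
    have hmin : m ∈ (Ideal.span (t.image g : Set (Localization.AtPrime P))).minimalPrimes := by
      rw [← hm, Ideal.minimalPrimes_eq_subsingleton_self]
      rfl
    have := (Ideal.height_le_card_of_mem_minimalPrimes_span_finset hmin).trans
      (Nat.cast_le.2 Finset.card_image_le)
    rwa [← IsLocalization.height_under P.primeCompl,
      IsLocalization.AtPrime.under_maximalIdeal _ P] at this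
  have h8 := hreg.spanFinrank_maximalIdeal
  rw [IsLocalization.AtPrime.ringKrullDim_eq_height p] at h8
  have h9 := (height_map_quotient_add_one_le h0 p).trans h7
  have h10 : p.height = (t.card : ℕ∞) := by
    rw [htc]; exact (WithBot.coe_injective h8).symm
  rw [h10] at h9
  exact absurd h9 (by exact_mod_cast (Nat.lt_succ_self _).not_ge)

/-- First order Taylor expansion, for two homomorphisms that agree modulo an ideal of square
zero. -/
theorem algHom_eq_add_sum_pderiv {k σ B : Type*} [Field k] [Fintype σ] [CommRing B] [Algebra k B]
    (a b : MvPolynomial σ k →ₐ[k] B)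
    (hab : ∀ i j, (a (X i) - b (X i)) * (a (X j) - b (X j)) = 0) (p : MvPolynomial σ k) :
    a p = b p + ∑ i, b (pderiv i p) * (a (X i) - b (X i)) := by
  classical
  induction p using MvPolynomial.induction_on with
  | C c => simp [← MvPolynomial.algebraMap_eq]
  | add p q hp hq =>
    rw [map_add, hp, hq, map_add]
    simp only [map_add, add_mul, Finset.sum_add_distrib]
    ring
  | mul_X p j hp =>
    have h1 : ∑ i, b (pderiv i (p * X j)) * (a (X i) - b (X i)) =
        (∑ i, b (pderiv i p) * (a (X i) - b (X i))) * b (X j) + b p * (a (X j) - b (X j)) := by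
      simp only [pderiv_mul, pderiv_X, map_add, map_mul, add_mul, Finset.sum_add_distrib,
        Finset.sum_mul]
      congr 1
      · exact Finset.sum_congr rfl fun i _ => by ring
      · rw [Finset.sum_eq_single j]
        · simp
        · intro i _ hij
          simp [hij.symm]
        · simp
    have h2 : (∑ i, b (pderiv i p) * (a (X i) - b (X i))) * (a (X j) - b (X j)) = 0 := by
      rw [Finset.sum_mul]
      exact Finset.sum_eq_zero fun i _ => by rw [mul_assoc, hab, mul_zero]
    rw [map_mul, h1, map_mul]
    have h3 : a (X j) = b (X j) + (a (X j) - b (X j)) := by ring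
    generalize (∑ i, b (pderiv i p) * (a (X i) - b (X i))) = S at *
    rw [hp]
    linear_combination h2

/-- In characteristic zero the residue field is formally smooth over `k`, so it embeds in the first
infinitesimal neighbourhood `A / m ^ 2` of the closed point. The section `τ` is recorded through
the vanishing of the products of the differences `a - τ a`, which lie in `m / m ^ 2`. -/
theorem exists_algHom_residueField_quotient_sq (k A : Type*) [Field k] [CharZero k] [CommRing A]
    [IsLocalRing A] [Algebra k A] [Algebra.EssFiniteType k A] :
    ∃ τ : IsLocalRing.ResidueField A →ₐ[k] A ⧸ IsLocalRing.maximalIdeal A ^ 2,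
      ∀ a a' : A, (Ideal.Quotient.mk _ a - τ (IsLocalRing.residue A a)) *
        (Ideal.Quotient.mk _ a' - τ (IsLocalRing.residue A a')) = 0 := by
  let m := IsLocalRing.maximalIdeal A
  let g : A ⧸ m ^ 2 →ₐ[k] IsLocalRing.ResidueField A := Ideal.Quotient.liftₐ (m ^ 2)
    (IsScalarTower.toAlgHom k A (IsLocalRing.ResidueField A)) (fun a ha => by
      have : a ∈ m := Ideal.pow_le_self two_ne_zero ha
      exact (IsLocalRing.residue_eq_zero_iff a).2 this)
  have hg : Function.Surjective g := fun x => by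
    obtain ⟨a, rfl⟩ := IsLocalRing.residue_surjective x
    exact ⟨Ideal.Quotient.mk _ a, rfl⟩
  have hker : ∀ x, g x = 0 → x ∈ m.map (Ideal.Quotient.mk (m ^ 2)) := by
    intro x hx
    obtain ⟨a, rfl⟩ := Ideal.Quotient.mk_surjective x
    exact Ideal.mem_map_of_mem _ ((IsLocalRing.residue_eq_zero_iff a).1 hx)
  have hsq : RingHom.ker (g : A ⧸ m ^ 2 →+* IsLocalRing.ResidueField A) ^ 2 = ⊥ := by
    have h1 : RingHom.ker (g : A ⧸ m ^ 2 →+* IsLocalRing.ResidueField A) ≤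
      m.map (Ideal.Quotient.mk (m ^ 2)) := fun x hx => hker x hx
    have h2 := Ideal.pow_right_mono h1 2
    rw [← Ideal.map_pow, Ideal.map_quotient_self] at h2
    exact le_bot_iff.1 h2
  have hnil : IsNilpotent (RingHom.ker (g : A ⧸ m ^ 2 →+* IsLocalRing.ResidueField A)) :=
    ⟨2, hsq⟩
  have : Algebra.EssFiniteType k (IsLocalRing.ResidueField A) :=
    .of_surjective (IsScalarTower.toAlgHom k A (IsLocalRing.ResidueField A))
      IsLocalRing.residue_surjective
  let τ := Algebra.FormallySmooth.liftOfSurjective (AlgHom.id k _) g hg hnil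
  have hτ : ∀ a : A, Ideal.Quotient.mk _ a - τ (IsLocalRing.residue A a) ∈
      RingHom.ker (g : A ⧸ m ^ 2 →+* IsLocalRing.ResidueField A) := fun a => by
    rw [RingHom.mem_ker, map_sub]
    exact sub_eq_zero.2 (Algebra.FormallySmooth.liftOfSurjective_apply (AlgHom.id k _) g hg hnil
      (IsLocalRing.residue A a)).symm
  refine ⟨τ, fun a a' => ?_⟩
  have h3 := Ideal.mul_mem_mul (hτ a) (hτ a')
  rw [← sq, hsq] at h3
  exact h3

/-- A polynomial that vanishes on `V(P)` together with its partial derivatives lies in `P ^ 2` at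
the generic point of `V(P)`. The Taylor formula compares `h` with its image under a section of
`R_P / P ^ 2 → κ(P)`. -/
theorem exists_mul_mem_sq_of_pderiv_mem {k σ : Type*} [Field k] [CharZero k] [Finite σ]
    (P : Ideal (MvPolynomial σ k)) [P.IsPrime] {h : MvPolynomial σ k} (hP : h ∈ P)
    (hd : ∀ i, pderiv i h ∈ P) : ∃ s ∉ P, s * h ∈ P ^ 2 := by
  have := Fintype.ofFinite σ
  obtain ⟨τ, hτ⟩ := exists_algHom_residueField_quotient_sq k (Localization.AtPrime P)
  let m := IsLocalRing.maximalIdeal (Localization.AtPrime P)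
  have hm : m = IsLocalRing.maximalIdeal (Localization.AtPrime P) := rfl
  let a : MvPolynomial σ k →ₐ[k] Localization.AtPrime P ⧸ m ^ 2 :=
    (Ideal.Quotient.mkₐ k (m ^ 2)).comp (IsScalarTower.toAlgHom k _ (Localization.AtPrime P))
  let b : MvPolynomial σ k →ₐ[k] Localization.AtPrime P ⧸ m ^ 2 :=
    τ.comp ((IsScalarTower.toAlgHom k (Localization.AtPrime P) _).comp
      (IsScalarTower.toAlgHom k _ (Localization.AtPrime P)))
  have hmem : ∀ p ∈ P, algebraMap _ (Localization.AtPrime P) p ∈ m := fun p hp => by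
    rw [hm, ← Localization.AtPrime.map_eq_maximalIdeal]
    exact Ideal.mem_map_of_mem _ hp
  have hb : ∀ p ∈ P, b p = 0 := fun p hp => by
    change τ (IsLocalRing.residue _ (algebraMap _ _ p)) = 0
    rw [(IsLocalRing.residue_eq_zero_iff _).2 (hmem p hp), map_zero]
  have h0 := algHom_eq_add_sum_pderiv (B := Localization.AtPrime P ⧸ m ^ 2) a b
    (fun i j => hτ _ _) h
  rw [hb h hP, Finset.sum_eq_zero (fun i _ => by rw [hb _ (hd i), zero_mul]), add_zero] at h0
  have h1 : algebraMap (MvPolynomial σ k) (Localization.AtPrime P) h ∈ m ^ 2 :=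
    Ideal.Quotient.eq_zero_iff_mem.1 h0
  rw [hm, ← Localization.AtPrime.map_eq_maximalIdeal, ← Ideal.map_pow,
    IsLocalization.algebraMap_mem_map_algebraMap_iff P.primeCompl] at h1
  exact h1

/-- An element that is a non-zero-divisor modulo high powers of `J` at `q` lies in no minimal prime
of `J` below `q`: a minimal prime of `J` is associated to every power of `J`. -/
theorem notMem_minimalPrimes_of_pow_cancel {B : Type*} [CommRing B] (J q P : Ideal B) [q.IsPrime]
    {u : B} (hP : P ∈ J.minimalPrimes) (hPq : P ≤ q)
    (H : ∃ N : ℕ, ∀ j ≥ N, ∀ y : Localization.AtPrime q,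
      algebraMap B (Localization.AtPrime q) u * y ∈
          J.map (algebraMap B (Localization.AtPrime q)) ^ j →
        y ∈ J.map (algebraMap B (Localization.AtPrime q)) ^ j) : u ∉ P := by
  intro hu
  obtain ⟨N, hN⟩ := H
  have hPp := hP.isPrime
  have hP' : P ∈ (J ^ (N + 1)).minimalPrimes := by
    rw [← Ideal.radical_minimalPrimes, Ideal.radical_pow _ (Nat.succ_ne_zero N),
      Ideal.radical_minimalPrimes]
    exact hP
  -- `u` is nilpotent modulo `J ^ (N + 1)` in the localization at the minimal prime `P`
  have hnil : ∃ s ∉ P, ∃ m : ℕ, u ^ m * s ∈ J ^ (N + 1) := by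
    have hle : P.map (algebraMap B (Localization.AtPrime P)) ≤
        ((J ^ (N + 1)).map (algebraMap _ _)).radical := by
      rw [Ideal.radical_eq_sInf, le_sInf_iff]
      rintro q' ⟨hq', hq⟩
      obtain ⟨h₁, h₂⟩ := ((IsLocalization.AtPrime.orderIsoOfPrime _ P) ⟨q', hq⟩).2
      rw [Ideal.map_le_iff_le_comap] at hq' ⊢
      exact hP'.2 ⟨h₁, hq'⟩ h₂
    obtain ⟨m, hm⟩ := hle (Ideal.mem_map_of_mem _ hu)
    rw [← map_pow, IsLocalization.algebraMap_mem_map_algebraMap_iff P.primeCompl] at hm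
    obtain ⟨s, hs, hsm⟩ := hm
    exact ⟨s, hs, m, by rwa [mul_comm]⟩
  obtain ⟨s, hs, m, hm⟩ := hnil
  have h1 := Ideal.mem_map_of_mem (algebraMap B (Localization.AtPrime q)) hm
  rw [Ideal.map_pow, map_mul, map_pow] at h1
  have h2 : algebraMap B (Localization.AtPrime q) s ∈
      J.map (algebraMap B (Localization.AtPrime q)) ^ (N + 1) := by
    clear hm
    induction m with
    | zero => simpa using h1
    | succ m ih =>
      apply ih
      apply hN _ (Nat.le_succ N)
      rwa [← mul_assoc, ← pow_succ']
  rw [← Ideal.map_pow, IsLocalization.algebraMap_mem_map_algebraMap_iff q.primeCompl] at h2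
  obtain ⟨t, ht, hts⟩ := h2
  rcases hPp.mem_or_mem (hP'.1.2 hts) with h | h
  · exact ht (hPq h)
  · exact hs h

/-! ### Blowing up a point of a hypersurface -/

theorem exists_prime_not_isRegularLocalRing {R : Type*} [CommRing R] [IsDomain R]
    [IsNoetherianRing R] {h s : R} (h0 : h ≠ 0) (P : Ideal R) [P.IsPrime] (hP : h ∈ P)
    (hht : P.height ≤ 2) (hs : s ∉ P) (hsh : s * h ∈ P ^ 2) :
    ∃ (p : Ideal (R ⧸ Ideal.span {h})) (_ : p.IsPrime), p.height ≤ 1 ∧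
      ¬ IsRegularLocalRing (Localization.AtPrime p) := by
  have hle : Ideal.span {h} ≤ P := (Ideal.span_singleton_le_iff_mem _).2 hP
  have hp : (P.map (Ideal.Quotient.mk (Ideal.span {h}))).IsPrime :=
    Ideal.map_isPrime_of_surjective Ideal.Quotient.mk_surjective (by rwa [Ideal.mk_ker])
  have hc : (P.map (Ideal.Quotient.mk (Ideal.span {h}))).comap (Ideal.Quotient.mk _) = P := by
    rw [Ideal.comap_map_of_surjective' _ Ideal.Quotient.mk_surjective, Ideal.mk_ker,
      sup_eq_left.2 hle]
  refine ⟨_, hp, ?_, not_isRegularLocalRing_of_mul_mem_sq h0 _ (s := s) ?_ (by rwa [hc])⟩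
  · have h1 := (height_map_quotient_add_one_le h0 (P.map (Ideal.Quotient.mk _)))
    rw [hc] at h1
    have h2 := h1.trans hht
    rw [← one_add_one_eq_two] at h2
    exact (ENat.add_le_add_iff_right ENat.one_ne_top).1 h2
  · rwa [← Ideal.mem_comap, hc]

/-- A hypersurface `A * B = 0` is singular in codimension one if `A` and `B` have a common zero. -/
theorem exists_prime_not_isRegularLocalRing_of_mul {k σ : Type*} [Field k] [Finite σ]
    {A B : MvPolynomial σ k} (h0 : A * B ≠ 0) (z : σ → k) (hA : eval z A = 0) (hB : eval z B = 0) :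
    ∃ (p : Ideal (MvPolynomial σ k ⧸ Ideal.span {A * B})) (_ : p.IsPrime), p.height ≤ 1 ∧
      ¬ IsRegularLocalRing (Localization.AtPrime p) := by
  classical
  have hker : (RingHom.ker (eval z)).IsPrime := RingHom.ker_isPrime _
  have hle : Ideal.span (({A, B} : Finset (MvPolynomial σ k)) : Set (MvPolynomial σ k)) ≤
      RingHom.ker (eval z) := by
    rw [Ideal.span_le]
    intro x hx
    simp only [Finset.coe_insert, Finset.coe_singleton, Set.mem_insert_iff,
      Set.mem_singleton_iff] at hx
    rcases hx with rfl | rfl <;> assumption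
  obtain ⟨Q, hQ, hQle⟩ := Ideal.exists_minimalPrimes_le hle
  have hQp := hQ.isPrime
  have hAQ : A ∈ Q := hQ.1.2 (Ideal.subset_span (by simp))
  have hBQ : B ∈ Q := hQ.1.2 (Ideal.subset_span (by simp))
  refine exists_prime_not_isRegularLocalRing h0 Q (Ideal.mul_mem_right _ _ hAQ) ?_
    (s := 1) ((Ideal.ne_top_iff_one _).1 hQp.ne_top) ?_
  · exact (Ideal.height_le_card_of_mem_minimalPrimes_span_finset hQ).trans
      (by exact_mod_cast Finset.card_le_two)
  · rw [one_mul, sq]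
    exact Ideal.mul_mem_mul hAQ hBQ

/-- If `φ` becomes an isomorphism when `a` is inverted, it preserves the height of primes that avoid
`a`. -/
theorem height_comap_of_away {R S : Type*} [CommRing R] [CommRing S] (φ : R →+* S) (a : R)
    (hinj : Function.Injective φ) (hsurj : ∀ y : S, ∃ (n : ℕ) (x : R), φ a ^ n * y = φ x)
    (P : Ideal S) [P.IsPrime] (haP : φ a ∉ P) : (P.comap φ).height = P.height := by
  let L := Localization.Away (φ a)
  let _ : Algebra R L := ((algebraMap S L).comp φ).toAlgebra
  have hL : IsLocalization (Submonoid.powers a) L := by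
    refine (isLocalization_iff _ _).2 ⟨?_, ?_, ?_⟩
    · rintro ⟨_, n, rfl⟩
      change IsUnit (algebraMap S L (φ (a ^ n)))
      rw [map_pow, map_pow]
      exact (IsLocalization.Away.algebraMap_isUnit (φ a)).pow n
    · intro z
      obtain ⟨m, y, hy⟩ := IsLocalization.Away.surj (φ a) z
      obtain ⟨n, x, hx⟩ := hsurj y
      refine ⟨(x, ⟨a ^ (m + n), m + n, rfl⟩), ?_⟩
      change z * algebraMap S L (φ (a ^ (m + n))) = algebraMap S L (φ x)
      rw [← hx, map_mul, ← hy, map_pow, map_pow, map_pow]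
      ring
    · intro x y hxy
      obtain ⟨⟨_, n, rfl⟩, hc⟩ := IsLocalization.exists_of_eq (M := Submonoid.powers (φ a)) hxy
      refine ⟨⟨a ^ n, n, rfl⟩, hinj ?_⟩
      simpa using hc
  have hd : Disjoint (Submonoid.powers (φ a) : Set S) (P : Set S) := by
    rw [Set.disjoint_left]
    rintro _ ⟨n, rfl⟩ hn
    exact haP (Ideal.IsPrime.mem_of_pow_mem ‹_› n hn)
  have h1 := IsLocalization.height_map_of_disjoint (S := L) (Submonoid.powers (φ a)) P hd
  have h2 := IsLocalization.height_under (Submonoid.powers a) (P.map (algebraMap S L))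
  rw [← h1, ← h2]
  congr 1
  change _ = Ideal.comap ((algebraMap S L).comp φ) _
  rw [← Ideal.comap_comap]
  congr 1
  exact (IsLocalization.under_map_of_isPrime_disjoint (Submonoid.powers (φ a)) L ‹_› hd).symm

section Blowup

variable {k σ : Type*} [Field k]

open Classical in
/-- The chart of index `f` of the blow-up of affine space at the origin, as a homomorphism of
coordinate rings. The exceptional divisor is `X f = 0`. -/
noncomputable def blowupChart (f : σ) : MvPolynomial σ k →ₐ[k] MvPolynomial σ k :=
  aeval fun g => if g = f then X f else X f * X g

open Classical in
/-- Dehomogenization with respect to the variable of index `f`. -/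
noncomputable def dehomogenize (f : σ) : MvPolynomial σ k →ₐ[k] MvPolynomial σ k :=
  aeval fun g => if g = f then 1 else X g

theorem blowupChart_X_self (f : σ) : blowupChart f (X f : MvPolynomial σ k) = X f := by
  simp [blowupChart]

theorem blowupChart_X_of_ne {f g : σ} (h : g ≠ f) :
    blowupChart f (X g : MvPolynomial σ k) = X f * X g := by
  simp [blowupChart, h]

theorem blowupChart_of_isHomogeneous (f : σ) {F : MvPolynomial σ k} {d : ℕ}
    (hF : F.IsHomogeneous d) : blowupChart f F = X f ^ d * dehomogenize f F := by
  classical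
  have h1 : ∀ g : σ, (if g = f then X f else X f * X g : MvPolynomial σ k) =
      X f * (if g = f then 1 else X g) := fun g => by split_ifs <;> simp
  rw [blowupChart, dehomogenize, aeval_def, aeval_def, eval₂_eq, eval₂_eq, Finset.mul_sum]
  refine Finset.sum_congr rfl fun m hm => ?_
  simp only [h1, mul_pow, Finset.prod_mul_distrib, Finset.prod_pow_eq_pow_sum]
  have h2 : ∑ i ∈ m.support, m i = d := by
    have := hF (mem_support_iff.1 hm)
    rw [Finsupp.weight_apply] at this
    simpa [Finsupp.sum] using this
  rw [h2]
  ring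

theorem blowupChart_injective (f : σ) :
    Function.Injective (blowupChart f : MvPolynomial σ k →ₐ[k] MvPolynomial σ k) := by
  classical
  let L := FractionRing (MvPolynomial σ k)
  -- a left inverse of the chart map, with values in the field of fractions
  let χ : MvPolynomial σ k →ₐ[k] L := aeval fun g =>
    if g = f then algebraMap (MvPolynomial σ k) L (X f)
    else algebraMap (MvPolynomial σ k) L (X g) / algebraMap (MvPolynomial σ k) L (X f)
  have hf : algebraMap (MvPolynomial σ k) L (X f) ≠ 0 := by
    rw [Ne, IsFractionRing.to_map_eq_zero_iff]
    exact X_ne_zero f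
  have hχ : χ.comp (blowupChart f) = IsScalarTower.toAlgHom k _ L := by
    ext g
    by_cases h : g = f
    · subst h; simp [χ, blowupChart_X_self]
    · simp [χ, blowupChart_X_of_ne h, h]
      exact mul_div_cancel₀ _ hf
  intro x y hxy
  apply IsFractionRing.injective (MvPolynomial σ k) L
  have h1 := DFunLike.congr_fun hχ x
  have h2 := DFunLike.congr_fun hχ y
  simp only [AlgHom.comp_apply, IsScalarTower.coe_toAlgHom'] at h1 h2
  rw [← h1, ← h2, hxy]

theorem exists_X_pow_mul_eq_blowupChart (f : σ) (y : MvPolynomial σ k) :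
    ∃ (n : ℕ) (x : MvPolynomial σ k), X f ^ n * y = blowupChart f x := by
  induction y using MvPolynomial.induction_on with
  | C c => exact ⟨0, C c, by simp [blowupChart]⟩
  | add p q hp hq =>
    obtain ⟨m, x, hx⟩ := hp
    obtain ⟨n, y, hy⟩ := hq
    refine ⟨m + n, X f ^ n * x + X f ^ m * y, ?_⟩
    rw [map_add, map_mul, map_mul, ← hx, ← hy, map_pow, map_pow, blowupChart_X_self]
    ring
  | mul_X p g hp =>
    obtain ⟨m, x, hx⟩ := hp
    by_cases h : g = f
    · subst h
      exact ⟨m, x * X g, by rw [map_mul, ← hx, blowupChart_X_self]; ring⟩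
    · exact ⟨m + 1, x * X g, by rw [map_mul, ← hx, blowupChart_X_of_ne h]; ring⟩

theorem height_comap_blowupChart (f : σ) (P : Ideal (MvPolynomial σ k)) [P.IsPrime]
    (hf : X f ∉ P) : (P.comap (blowupChart f)).height = P.height := by
  refine height_comap_of_away (blowupChart f : MvPolynomial σ k →ₐ[k] MvPolynomial σ k).toRingHom
    (X f) (blowupChart_injective f) (fun y => ?_) P ?_
  · obtain ⟨n, x, hx⟩ := exists_X_pow_mul_eq_blowupChart f y
    refine ⟨n, x, ?_⟩
    change blowupChart f (X f) ^ n * y = blowupChart f x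
    rw [blowupChart_X_self, hx]
  · change blowupChart f (X f) ∉ P
    rwa [blowupChart_X_self]

theorem pderiv_algHom [Fintype σ] (φ : MvPolynomial σ k →ₐ[k] MvPolynomial σ k) (i : σ)
    (p : MvPolynomial σ k) :
    pderiv i (φ p) = ∑ j, φ (pderiv j p) * pderiv i (φ (X j)) := by
  classical
  induction p using MvPolynomial.induction_on with
  | C c => simp [← MvPolynomial.algebraMap_eq]
  | add p q hp hq => simp only [map_add, hp, hq, add_mul, Finset.sum_add_distrib]
  | mul_X p l hp =>
    rw [map_mul, pderiv_mul, hp, Finset.sum_mul]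
    simp only [pderiv_mul, pderiv_X, map_add, map_mul, add_mul, Finset.sum_add_distrib]
    congr 1
    · exact Finset.sum_congr rfl fun i _ => by ring
    · rw [Finset.sum_eq_single l]
      · simp
      · intro i _ hij
        simp [hij.symm]
      · simp

theorem pderiv_mem_of_blowupChart [Finite σ] (f : σ) (P : Ideal (MvPolynomial σ k)) [P.IsPrime]
    (hf : X f ∉ P) (p : MvPolynomial σ k) (hp : ∀ i, pderiv i (blowupChart f p) ∈ P) (i : σ) :
    blowupChart f (pderiv i p) ∈ P := by
  classical
  have := Fintype.ofFinite σ
  have h1 : ∀ g ≠ f, blowupChart f (pderiv g p) ∈ P := by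
    intro g hg
    have h2 := hp g
    rw [pderiv_algHom, Finset.sum_eq_single g] at h2
    · rw [blowupChart_X_of_ne hg, pderiv_mul, pderiv_X_of_ne hg.symm, pderiv_X_self, zero_mul,
        zero_add, mul_one] at h2
      exact (Ideal.IsPrime.mem_or_mem ‹_› h2).resolve_right hf
    · intro j _ hj
      by_cases hjf : j = f
      · subst hjf
        rw [blowupChart_X_self, pderiv_X_of_ne hj, mul_zero]
      · rw [blowupChart_X_of_ne hjf, pderiv_mul, pderiv_X_of_ne hg.symm, pderiv_X_of_ne hj]
        simp
    · simp
  by_cases hi : i = f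
  · subst hi
    have h2 := hp i
    rw [pderiv_algHom, ← Finset.add_sum_erase _ _ (Finset.mem_univ i), blowupChart_X_self,
      pderiv_X_self, mul_one] at h2
    refine (Ideal.add_mem_iff_left _ (Ideal.sum_mem _ fun j hj => ?_)).1 h2
    exact Ideal.mul_mem_right _ _ (h1 j (Finset.ne_of_mem_erase hj))
  · exact h1 i hi

theorem eval_update_dehomogenize [DecidableEq σ] (f : σ) (z : σ → k) (hz : z f = 1) (c : k)
    (p : MvPolynomial σ k) : eval (Function.update z f c) (dehomogenize f p) = eval z p := by
  have : ((aeval (Function.update z f c)).comp (dehomogenize f) : MvPolynomial σ k →ₐ[k] k) =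
      aeval z := by
    ext g
    by_cases h : g = f
    · subst h; simp [dehomogenize, hz]
    · simp [dehomogenize, h]
  have := DFunLike.congr_fun this p
  simpa [aeval_eq_eval] using this

/-- Let `K` be the ideal of the strict transform of `F₁ * F₂ + G = 0` in a chart of the blow-up at
the origin, where `F₁ * F₂` is the tangent cone and `G ∈ (F₁, F₂)` is homogeneous of the next degree.
If, along the exceptional divisor, its equation is a non-zero-divisor modulo high powers of the
singularity ideal, then `F₁ * F₂ + G = 0` is singular in codimension one, provided the tangent cone
has a singular point `F₁ = F₂ = 0` in the chart. Indeed the singularity subscheme then contains the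
locus `F₁ = F₂ = u = 0`, of codimension at most `3`, where `u` is the equation of the exceptional
divisor, and has a component through it that is not contained in `u = 0`; this component has
codimension at most `2`. -/
theorem exists_prime_not_isRegularLocalRing_of_pow_cancel [CharZero k] [Finite σ] (f : σ)
    {F₁ F₂ G : MvPolynomial σ k} {d : ℕ} (hF : (F₁ * F₂).IsHomogeneous d)
    (hG : G.IsHomogeneous (d + 1)) (hGF : G ∈ Ideal.span {F₁, F₂})
    (hF0 : eval (fun _ => 1) (F₁ * F₂) ≠ 0) (z : σ → k) (hzf : z f = 1) (hz₁ : eval z F₁ = 0)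
    (hz₂ : eval z F₂ = 0) (K : Ideal (MvPolynomial σ k))
    (hK : ∀ q, q ∈ K ↔ ∃ N : ℕ, X f ^ N * q ∈ Ideal.span {blowupChart f (F₁ * F₂ + G)})
    (hII : ∀ (q : Ideal (MvPolynomial σ k ⧸ K)) [q.IsMaximal],
      Ideal.Quotient.mk K (X f) ∈ q → singularityIdeal K ≤ q →
      ∃ N : ℕ, ∀ j ≥ N, ∀ y : Localization.AtPrime q,
        algebraMap _ (Localization.AtPrime q) (Ideal.Quotient.mk K (X f)) * y ∈
          (singularityIdeal K).map (algebraMap _ (Localization.AtPrime q)) ^ j →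
        y ∈ (singularityIdeal K).map (algebraMap _ (Localization.AtPrime q)) ^ j) :
    ∃ (p : Ideal (MvPolynomial σ k ⧸ Ideal.span {F₁ * F₂ + G})) (_ : p.IsPrime), p.height ≤ 1 ∧
      ¬ IsRegularLocalRing (Localization.AtPrime p) := by
  classical
  set F := F₁ * F₂ with hFdef
  set h := dehomogenize f F + X f * dehomogenize f G with hh
  have hpull : blowupChart f (F + G) = X f ^ d * h := by
    rw [map_add, blowupChart_of_isHomogeneous f hF, blowupChart_of_isHomogeneous f hG, hh]
    ring
  have hXh : ¬ X f ∣ h := by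
    rintro ⟨c, hc⟩
    have h1 := congrArg (eval (Function.update (fun _ => (1 : k)) f 0)) hc
    rw [hh, map_add, eval_update_dehomogenize f _ rfl, map_mul _ (X f), map_mul _ (X f) c, eval_X,
      Function.update_self, zero_mul, zero_mul, add_zero] at h1
    exact hF0 h1
  have hXp : Prime (X f : MvPolynomial σ k) := X_prime
  -- `h` is the equation of the strict transform, as it is not divisible by `X f`
  have hKh : K = Ideal.span {h} := by
    ext q
    rw [hK, Ideal.mem_span_singleton, hpull]
    simp only [Ideal.mem_span_singleton]
    constructor
    · rintro ⟨N, c, hc⟩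
      have h1 : h ∣ X f ^ N * q := ⟨X f ^ d * c, by rw [hc]; ring⟩
      have h2 : IsRelPrime h (X f ^ N) :=
        ((hXp.irreducible.isRelPrime_iff_not_dvd).2 hXh).symm.pow_right
      exact h2.dvd_of_dvd_mul_left h1
    · rintro ⟨c, hc⟩
      exact ⟨d, c, by rw [hc]; ring⟩
  -- the point of the exceptional divisor determined by `z`
  set z' := Function.update z f 0 with hz'
  set Fs : Finset (MvPolynomial σ k) := {dehomogenize f F₁, dehomogenize f F₂, X f} with hFs
  have hle : Ideal.span (Fs : Set (MvPolynomial σ k)) ≤ RingHom.ker (eval z') := by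
    rw [Ideal.span_le]
    intro x hx
    simp only [hFs, Finset.coe_insert, Finset.coe_singleton, Set.mem_insert_iff,
      Set.mem_singleton_iff] at hx
    rw [SetLike.mem_coe, RingHom.mem_ker]
    rcases hx with rfl | rfl | rfl
    · rw [hz', eval_update_dehomogenize f z hzf, hz₁]
    · rw [hz', eval_update_dehomogenize f z hzf, hz₂]
    · simp [hz']
  have hker : (RingHom.ker (eval z')).IsPrime := RingHom.ker_isPrime _
  obtain ⟨Q, hQ, hQz⟩ := Ideal.exists_minimalPrimes_le hle
  have hQp := hQ.isPrime
  have hQht : Q.height ≤ 3 :=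
    (Ideal.height_le_card_of_mem_minimalPrimes_span_finset hQ).trans
      (by exact_mod_cast Finset.card_le_three)
  have hF₁Q : dehomogenize f F₁ ∈ Q := hQ.1.2 (Ideal.subset_span (by simp [hFs]))
  have hF₂Q : dehomogenize f F₂ ∈ Q := hQ.1.2 (Ideal.subset_span (by simp [hFs]))
  have hXQ : X f ∈ Q := hQ.1.2 (Ideal.subset_span (by simp [hFs]))
  have hGQ : dehomogenize f G ∈ Q := by
    obtain ⟨a, b, rfl⟩ := Ideal.mem_span_pair.1 hGF
    rw [map_add, map_mul, map_mul]
    exact add_mem (Ideal.mul_mem_left _ _ hF₁Q) (Ideal.mul_mem_left _ _ hF₂Q)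
  have hhQ : h ∈ Q := by
    rw [hh, hFdef, map_mul]
    exact add_mem (Ideal.mul_mem_right _ _ hF₁Q) (Ideal.mul_mem_right _ _ hXQ)
  have hdhQ : ∀ i, pderiv i h ∈ Q := by
    intro i
    rw [hh, hFdef, map_mul, map_add, pderiv_mul, pderiv_mul]
    exact add_mem (add_mem (Ideal.mul_mem_left _ _ hF₂Q) (Ideal.mul_mem_right _ _ hF₁Q))
      (add_mem (Ideal.mul_mem_left _ _ hGQ) (Ideal.mul_mem_right _ _ hXQ))
  have hKQ : K ≤ Q := by
    rw [hKh]; exact (Ideal.span_singleton_le_iff_mem _).2 hhQ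
  have hcQ : (Q.map (Ideal.Quotient.mk K)).comap (Ideal.Quotient.mk K) = Q := by
    rw [Ideal.comap_map_of_surjective' _ Ideal.Quotient.mk_surjective, Ideal.mk_ker,
      sup_eq_left.2 hKQ]
  have hQBp : (Q.map (Ideal.Quotient.mk K)).IsPrime :=
    Ideal.map_isPrime_of_surjective Ideal.Quotient.mk_surjective (by rwa [Ideal.mk_ker])
  have hSQ : singularityIdeal K ≤ Q.map (Ideal.Quotient.mk K) := by
    rw [singularityIdeal, Ideal.span_le]
    rintro _ ⟨h', hh', i, rfl⟩
    rw [hKh, Ideal.mem_span_singleton] at hh'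
    obtain ⟨c, rfl⟩ := hh'
    refine Ideal.mem_map_of_mem _ ?_
    rw [pderiv_mul]
    exact add_mem (Ideal.mul_mem_right _ _ (hdhQ i)) (Ideal.mul_mem_right _ _ hhQ)
  obtain ⟨PB, hPB, hPBQ⟩ := Ideal.exists_minimalPrimes_le hSQ
  have hPBp := hPB.isPrime
  let q : Ideal (MvPolynomial σ k ⧸ K) :=
    RingHom.ker (Ideal.Quotient.lift K (eval z') fun x hx => RingHom.mem_ker.1 (hQz (hKQ hx)))
  have hQq : Q.map (Ideal.Quotient.mk K) ≤ q := by
    rw [Ideal.map_le_iff_le_comap]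
    intro x hx
    exact hQz hx
  have hqm : q.IsMaximal := RingHom.ker_isMaximal_of_surjective _ fun c =>
    ⟨Ideal.Quotient.mk K (C c), by rw [Ideal.Quotient.lift_mk, eval_C]⟩
  have hu : Ideal.Quotient.mk K (X f) ∉ PB :=
    notMem_minimalPrimes_of_pow_cancel _ q PB hPB (hPBQ.trans hQq)
      (hII q (hQq (Ideal.mem_map_of_mem _ hXQ)) (hSQ.trans hQq))
  set P := PB.comap (Ideal.Quotient.mk K) with hP
  have hPQ : P < Q := by
    refine lt_of_le_of_ne ((Ideal.comap_mono hPBQ).trans hcQ.le) ?_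
    rintro hc
    exact hu (by rw [← Ideal.mem_comap, ← hP, hc]; exact hXQ)
  have hPht : P.height ≤ 2 := by
    have h1 := (Ideal.height_add_one_le_of_lt_of_isPrime hPQ).trans hQht
    rw [← two_add_one_eq_three] at h1
    exact (ENat.add_le_add_iff_right ENat.one_ne_top).1 h1
  have hhK : h ∈ K := by rw [hKh]; exact Ideal.mem_span_singleton_self h
  have hhP : h ∈ P := by
    rw [hP, Ideal.mem_comap, Ideal.Quotient.eq_zero_iff_mem.2 hhK]
    exact zero_mem _
  have hdP : ∀ i, pderiv i h ∈ P := fun i =>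
    hPB.1.2 (Ideal.subset_span ⟨h, hhK, i, rfl⟩)
  have hXP : X f ∉ P := hu
  -- pull back to the affine chart of the hypersurface
  have hder : ∀ i, pderiv i (F + G) ∈ P.comap (blowupChart f) := fun i =>
    pderiv_mem_of_blowupChart f P hXP (F + G) (fun i => by
      rw [hpull, pderiv_mul]
      exact add_mem (Ideal.mul_mem_left _ _ hhP) (Ideal.mul_mem_left _ _ (hdP i))) i
  have hmem : F + G ∈ P.comap (blowupChart f) := by
    rw [Ideal.mem_comap, hpull]
    exact Ideal.mul_mem_left _ _ hhP
  have hP'p : (P.comap (blowupChart f)).IsPrime := Ideal.comap_isPrime _ _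
  obtain ⟨s, hs, hsh⟩ := exists_mul_mem_sq_of_pderiv_mem _ hmem hder
  refine exists_prime_not_isRegularLocalRing ?_ _ hmem ?_ hs hsh
  · intro h0
    rw [h0, map_zero] at hpull
    rcases mul_eq_zero.1 hpull.symm with h1 | h1
    · exact pow_ne_zero d (X_ne_zero f) h1
    · exact hXh (h1 ▸ dvd_zero _)
  · exact (height_comap_blowupChart f P hXP).trans_le hPht

end Blowup

/-! ### Polynomials of vector configurations -/

section Configurations

variable {β K M M' : Type*} [Field K] [AddCommGroup M] [Module K M] [AddCommGroup M'] [Module K M']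

variable (K) in
/-- `T` is a basis of `E` for the family of vectors `v`, that is, a maximal subset of `E` on which
`v` is linearly independent; maximality is expressed by `v '' T` spanning `v '' E`. -/
def IsBasisOn (v : β → M) (E T : Set β) : Prop :=
  T ⊆ E ∧ LinearIndepOn K v T ∧ v '' E ⊆ Submodule.span K (v '' T)

theorem maximal_linearIndepOn_iff (v : β → M) (E T : Set β) :
    Maximal (fun S => S ⊆ E ∧ LinearIndepOn K v S) T ↔ IsBasisOn K v E T := by
  constructor
  · rintro ⟨⟨hTE, hT⟩, hmax⟩
    refine ⟨hTE, hT, ?_⟩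
    rintro _ ⟨g, hg, rfl⟩
    by_contra hgs
    exact hgs (Submodule.subset_span ⟨g, hmax ⟨Set.insert_subset hg hTE, hT.insert hgs⟩
      (Set.subset_insert g T) (Set.mem_insert g T), rfl⟩)
  · rintro ⟨hTE, hT, hs⟩
    refine ⟨⟨hTE, hT⟩, ?_⟩
    rintro S ⟨hSE, hS⟩ hTS g hg
    by_contra hgT
    refine hS.notMem_span hg (Submodule.span_mono (Set.image_mono ?_) (hs ⟨g, hSE hg, rfl⟩))
    exact fun x hx => ⟨hTS hx, fun h => hgT (h ▸ hx)⟩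

theorem exists_isBasisOn (v : β → M) (E : Set β) : ∃ T, IsBasisOn K v E T := by
  obtain ⟨b, hb, -, hs, hi⟩ := exists_linearIndepOn_extension (linearIndepOn_empty K v)
    (Set.empty_subset E)
  exact ⟨b, hb, hi, hs⟩

theorem IsBasisOn.span_eq {v : β → M} {E T : Set β} (hT : IsBasisOn K v E T) :
    Submodule.span K (v '' T) = Submodule.span K (v '' E) :=
  le_antisymm (Submodule.span_mono (Set.image_mono hT.1)) (Submodule.span_le.2 hT.2.2)

theorem IsBasisOn.ncard_eq_finrank {v : β → M} {E T : Set β} (hE : E.Finite)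
    (hT : IsBasisOn K v E T) :
    T.ncard = Module.finrank K (Submodule.span K (v '' E)) := by
  have := (hE.subset hT.1).fintype
  rw [← hT.span_eq, Set.image_eq_range, finrank_span_eq_card hT.2.1, Set.ncard_eq_toFinset_card',
    Set.toFinset_card]

theorem IsBasisOn.ncard_sdiff_eq {v : β → M} {E T T' : Set β} (hE : E.Finite)
    (hT : IsBasisOn K v E T) (hT' : IsBasisOn K v E T') : (E \ T).ncard = (E \ T').ncard := by
  rw [Set.ncard_sdiff hT.1 (hE.subset hT.1), Set.ncard_sdiff hT'.1 (hE.subset hT'.1),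
    hT.ncard_eq_finrank hE, hT'.ncard_eq_finrank hE]

theorem IsBasisOn.congr {v : β → M} {w : β → M} {E T : Set β} (h : Set.EqOn v w E)
    (hT : IsBasisOn K v E T) : IsBasisOn K w E T := by
  refine ⟨hT.1, hT.2.1.congr (h.mono hT.1), ?_⟩
  rw [← h.image_eq, ← (h.mono hT.1).image_eq]
  exact hT.2.2

theorem isBasisOn_congr {v : β → M} {w : β → M} {E T : Set β} (h : Set.EqOn v w E) :
    IsBasisOn K v E T ↔ IsBasisOn K w E T := ⟨.congr h, .congr h.symm⟩

theorem finite_setOf_isBasisOn (v : β → M) {E : Set β} (hE : E.Finite) :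
    {T | IsBasisOn K v E T}.Finite := hE.finite_subsets.subset fun _ h => h.1

theorem mem_toFinset_isBasisOn {v : β → M} {E T : Set β} (hE : E.Finite) :
    T ∈ (finite_setOf_isBasisOn (K := K) v hE).toFinset ↔ IsBasisOn K v E T :=
  Set.Finite.mem_toFinset _

theorem isBasisOn_sdiff_iff_of_mem_span {v : β → M} {E : Set β} {e : β}
    (hv : v e ∈ Submodule.span K (v '' (E \ {e}))) {T : Set β} (heT : e ∉ T) :
    IsBasisOn K v E T ↔ IsBasisOn K v (E \ {e}) T := by
  refine and_congr ⟨fun h x hx => ⟨h hx, fun h => heT (h ▸ hx)⟩, fun h => h.trans Set.sdiff_subset⟩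
    (and_congr Iff.rfl ⟨fun h => (Set.image_mono Set.sdiff_subset).trans h, fun h => ?_⟩)
  rintro _ ⟨g, hg, rfl⟩
  by_cases hge : g = e
  · subst hge
    exact Submodule.span_le.2 h hv
  · exact h ⟨g, ⟨hg, hge⟩, rfl⟩

theorem insert_subset_iff_subset_sdiff {E T : Set β} {e : β} (he : e ∈ E) (heT : e ∉ T) :
    insert e T ⊆ E ↔ T ⊆ E \ {e} := by
  rw [Set.insert_subset_iff, and_iff_right he]
  exact ⟨fun h g hg => ⟨h hg, fun hge => heT (hge ▸ hg)⟩, fun h => h.trans Set.sdiff_subset⟩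

theorem isBasisOn_insert_iff_of_notMem_span {v : β → M} {E : Set β} {e : β} (he : e ∈ E)
    (hv : v e ∉ Submodule.span K (v '' (E \ {e}))) {T : Set β} (heT : e ∉ T) :
    IsBasisOn K v E (insert e T) ↔ IsBasisOn K v (E \ {e}) T := by
  rw [IsBasisOn, IsBasisOn, insert_subset_iff_subset_sdiff he heT]
  refine and_congr_right fun hTE => ?_
  have hvT : v e ∉ Submodule.span K (v '' T) := fun h =>
    hv (Submodule.span_mono (Set.image_mono hTE) h)
  rw [linearIndepOn_insert heT, and_iff_left hvT, Set.image_insert_eq]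
  refine and_congr_right fun _ => ⟨fun h => ?_, fun h => ?_⟩
  · rintro _ ⟨g, hg, rfl⟩
    obtain ⟨c, y, hy, hgy⟩ := Submodule.mem_span_insert.1 (h ⟨g, hg.1, rfl⟩)
    have hc : c • v e ∈ Submodule.span K (v '' (E \ {e})) := by
      have : c • v e = v g - y := by rw [hgy]; abel
      rw [this]
      exact sub_mem (Submodule.subset_span ⟨g, hg, rfl⟩)
        (Submodule.span_mono (Set.image_mono hTE) hy)
    have hc0 : c = 0 := by
      by_contra hc0
      exact hv ((Submodule.smul_mem_iff _ hc0).1 hc)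
    rw [hgy, hc0, zero_smul, zero_add]
    exact hy
  · rintro _ ⟨g, hg, rfl⟩
    by_cases hge : g = e
    · subst hge
      exact Submodule.subset_span (Set.mem_insert _ _)
    · exact Submodule.span_mono (Set.subset_insert _ _) (h ⟨g, ⟨hg, hge⟩, rfl⟩)

/-- Bases of a contraction: `π` is the projection from the vector `v e`. -/
theorem isBasisOn_insert_iff_of_ker {v : β → M} {E : Set β} {e : β} (he : e ∈ E) (hv : v e ≠ 0)
    (π : M →ₗ[K] M') (hπ : LinearMap.ker π = Submodule.span K {v e}) {T : Set β} (heT : e ∉ T) :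
    IsBasisOn K v E (insert e T) ↔ IsBasisOn K (π ∘ v) (E \ {e}) T := by
  rw [IsBasisOn, IsBasisOn, insert_subset_iff_subset_sdiff he heT]
  have hπe : π (v e) = 0 := by
    rw [← LinearMap.mem_ker, hπ]
    exact Submodule.mem_span_singleton_self _
  refine and_congr_right fun hTE => and_congr ?_ ?_
  · have hd : Disjoint {e} T := Set.disjoint_singleton_left.2 heT
    rw [← Set.singleton_union, linearIndepOn_union_iff_quotient hd,
      and_iff_right (LinearIndepOn.singleton hv), Set.image_singleton, ← hπ]
    have h1 : π ∘ v = (LinearMap.ker π).liftQ π le_rfl ∘ ((LinearMap.ker π).mkQ ∘ v) := by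
      ext g; simp
    rw [h1]
    exact (LinearMap.linearIndepOn_iff_of_injOn _
      (LinearMap.ker_eq_bot.1 (Submodule.ker_liftQ_eq_bot _ _ _ le_rfl)).injOn).symm
  · have h2 : ∀ x, x ∈ Submodule.span K (v '' insert e T) ↔
        π x ∈ Submodule.span K ((π ∘ v) '' T) := by
      intro x
      rw [Set.image_comp, Submodule.span_image, Set.image_insert_eq, Submodule.span_insert, ← hπ,
        sup_comm, ← Submodule.comap_map_eq, Submodule.mem_comap]
    constructor
    · rintro h _ ⟨g, hg, rfl⟩
      exact (h2 _).1 (h ⟨g, hg.1, rfl⟩)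
    · rintro h _ ⟨g, hg, rfl⟩
      refine (h2 _).2 ?_
      by_cases hge : g = e
      · rw [hge, hπe]; exact zero_mem _
      · exact h ⟨g, ⟨hg, hge⟩, rfl⟩

theorem isBasisOn_union_iff {v : β → M} {E₁ E₂ : Set β}
    (hd : Disjoint (Submodule.span K (v '' E₁)) (Submodule.span K (v '' E₂))) {T : Set β}
    (hT : T ⊆ E₁ ∪ E₂) :
    IsBasisOn K v (E₁ ∪ E₂) T ↔ IsBasisOn K v E₁ (T ∩ E₁) ∧ IsBasisOn K v E₂ (T ∩ E₂) := by
  have hTu : T = (T ∩ E₁) ∪ (T ∩ E₂) := by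
    rw [← Set.inter_union_distrib_left, Set.inter_eq_left.2 hT]
  have hs : Submodule.span K (v '' T) =
      Submodule.span K (v '' (T ∩ E₁)) ⊔ Submodule.span K (v '' (T ∩ E₂)) := by
    rw [← Submodule.span_union, ← Set.image_union, ← hTu]
  -- a modular law for subspaces of independent subspaces
  have key : ∀ {A₁ A₂ N₁ N₂ : Submodule K M}, Disjoint N₁ N₂ → A₁ ≤ N₁ → A₂ ≤ N₂ →
      ∀ x ∈ N₁, x ∈ A₁ ⊔ A₂ → x ∈ A₁ := by
    intro A₁ A₂ N₁ N₂ hN h₁ h₂ x hx hxA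
    obtain ⟨a, ha, b, hb, rfl⟩ := Submodule.mem_sup.1 hxA
    have hb0 : b = 0 := by
      refine Submodule.disjoint_def.1 hN b ?_ (h₂ hb)
      exact (Submodule.add_mem_iff_right _ (h₁ ha)).1 hx
    rwa [hb0, add_zero]
  have hm₁ := Submodule.span_mono (R := K)
    (Set.image_mono (f := v) (Set.inter_subset_right (s := T) (t := E₁)))
  have hm₂ := Submodule.span_mono (R := K)
    (Set.image_mono (f := v) (Set.inter_subset_right (s := T) (t := E₂)))
  constructor
  · rintro ⟨-, hi, hsp⟩
    refine ⟨⟨Set.inter_subset_right, hi.mono Set.inter_subset_left, ?_⟩,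
      ⟨Set.inter_subset_right, hi.mono Set.inter_subset_left, ?_⟩⟩
    · rintro _ ⟨g, hg, rfl⟩
      refine key hd hm₁ hm₂ _ (Submodule.subset_span ⟨g, hg, rfl⟩) ?_
      rw [← hs]
      exact hsp ⟨g, Or.inl hg, rfl⟩
    · rintro _ ⟨g, hg, rfl⟩
      refine key hd.symm hm₂ hm₁ _ (Submodule.subset_span ⟨g, hg, rfl⟩) ?_
      rw [sup_comm, ← hs]
      exact hsp ⟨g, Or.inr hg, rfl⟩
  · rintro ⟨h₁, h₂⟩
    refine ⟨hT, ?_, ?_⟩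
    · rw [hTu]
      exact h₁.2.1.union h₂.2.1 (hd.mono hm₁ hm₂)
    · rw [hs]
      rintro _ ⟨g, hg | hg, rfl⟩
      · exact Submodule.mem_sup_left (h₁.2.2 ⟨g, hg, rfl⟩)
      · exact Submodule.mem_sup_right (h₂.2.2 ⟨g, hg, rfl⟩)

variable (K) in
/-- The sum, over the maximal linearly independent subsets `T` of a family of vectors `v` indexed
by `E`, of the products of the variables `t_g` with `g ∈ E ∖ T`. -/
noncomputable def configPoly (k : Type*) [Field k] (v : β → M) (E : Set β) : MvPolynomial β k :=
  ∑ᶠ (T : Set β) (_ : IsBasisOn K v E T), ∏ᶠ (g : β) (_ : g ∈ E \ T), X g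

variable {k : Type*} [Field k]

theorem configPoly_congr {v w : β → M} {E : Set β} (h : Set.EqOn v w E) :
    configPoly K k v E = configPoly K k w E := by
  simp only [configPoly, isBasisOn_congr h]

theorem configPoly_eq_sum (v : β → M) {E : Set β} (hE : E.Finite) :
    configPoly K k v E = ∑ T ∈ (finite_setOf_isBasisOn (K := K) v hE).toFinset,
      ∏ g ∈ (hE.sdiff (t := T)).toFinset, X g := by
  rw [configPoly]
  simp only [fun T : Set β => finprod_mem_eq_finite_toFinset_prod
    (fun g => (X g : MvPolynomial β k)) (hE.sdiff (t := T))]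
  exact finsum_mem_eq_finite_toFinset_sum _ (finite_setOf_isBasisOn v hE)

theorem configPoly_mem_supported (v : β → M) {E : Set β} (hE : E.Finite) :
    configPoly K k v E ∈ supported k E := by
  rw [configPoly_eq_sum v hE]
  refine sum_mem fun T _ => prod_mem fun g hg => ?_
  rw [X_mem_supported]
  exact ((Set.Finite.mem_toFinset _).1 hg).1

theorem isHomogeneous_configPoly {v : β → M} {E T : Set β} (hE : E.Finite)
    (hT : IsBasisOn K v E T) : (configPoly K k v E).IsHomogeneous (E \ T).ncard := by
  rw [configPoly_eq_sum v hE]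
  refine IsHomogeneous.sum _ _ _ fun T' hT' => ?_
  have h1 := IsHomogeneous.prod (hE.sdiff (t := T')).toFinset (fun g => (X g : MvPolynomial β k))
    (fun _ => 1) (fun g _ => isHomogeneous_X k g)
  rw [hT.ncard_sdiff_eq hE ((mem_toFinset_isBasisOn hE).1 hT')]
  rw [Set.ncard_eq_toFinset_card _ hE.sdiff]
  simpa using h1

theorem eval_one_configPoly_ne_zero [CharZero k] (v : β → M) {E : Set β} (hE : E.Finite) :
    eval (fun _ => 1) (configPoly K k v E) ≠ 0 := by
  obtain ⟨T, hT⟩ := exists_isBasisOn (K := K) v E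
  rw [configPoly_eq_sum v hE]
  simp only [map_sum, map_prod, eval_X, Finset.prod_const_one, Finset.sum_const, nsmul_eq_mul,
    mul_one]
  exact_mod_cast Finset.card_ne_zero_of_mem ((mem_toFinset_isBasisOn hE).2 hT)

/-- The polynomial has a zero with `t_f = 1` if `f` does not divide the monomial of some `T ≠ E`. In
degree `1` it is `t_a + c * t_f` after the other variables are set to zero; in higher degree it
vanishes where all variables but `t_f` do. -/
theorem exists_eval_configPoly_eq_zero {v : β → M} {E T : Set β} (hE : E.Finite)
    (hT : IsBasisOn K v E T) (hTE : T ≠ E) {f : β} (hf : f ∉ E \ T) :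
    ∃ z : β → k, z f = 1 ∧ eval z (configPoly K k v E) = 0 := by
  classical
  obtain ⟨a, ha⟩ : (E \ T).Nonempty := Set.sdiff_nonempty.2 fun h => hTE (hT.1.antisymm h)
  have haf : a ≠ f := fun h => hf (h ▸ ha)
  rw [configPoly_eq_sum v hE]
  simp only [map_sum, map_prod, eval_X]
  by_cases hcard : (E \ T).ncard = 1
  · have hTa : ∀ T', IsBasisOn K v E T' → a ∈ E \ T' → T' = T := by
      intro T' hT' haT'
      obtain ⟨b, hb⟩ := Set.ncard_eq_one.1 hcard
      obtain ⟨b', hb'⟩ := Set.ncard_eq_one.1 ((hT'.ncard_sdiff_eq hE hT).trans hcard)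
      rw [hb] at ha
      rw [hb'] at haT'
      rw [← Set.sdiff_sdiff_cancel_left hT'.1, ← Set.sdiff_sdiff_cancel_left hT.1, hb, hb',
        ← Set.mem_singleton_iff.1 ha, ← Set.mem_singleton_iff.1 haT']
    have haT : (hE.sdiff (t := T)).toFinset = {a} := by
      obtain ⟨b, hb⟩ := Set.ncard_eq_one.1 hcard
      rw [hb] at ha
      ext g
      rw [Set.Finite.mem_toFinset, hb, Set.mem_singleton_iff.1 ha, Set.mem_singleton_iff,
        Finset.mem_singleton]
    have hTm : T ∈ (finite_setOf_isBasisOn (K := K) v hE).toFinset :=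
      (Set.Finite.mem_toFinset _).2 hT
    let N : k := ∑ T' ∈ (finite_setOf_isBasisOn (K := K) v hE).toFinset.erase T,
      ∏ g ∈ (hE.sdiff (t := T')).toFinset, if g = f then 1 else 0
    refine ⟨fun g => if g = f then 1 else if g = a then -N else 0, by simp, ?_⟩
    rw [← Finset.add_sum_erase _ _ hTm, haT, Finset.prod_singleton, if_neg haf, if_pos rfl,
      neg_add_eq_zero]
    refine Finset.sum_congr rfl fun T' hT' => Finset.prod_congr rfl fun g hg => ?_
    rw [Finset.mem_erase, Set.Finite.mem_toFinset] at hT'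
    rw [Set.Finite.mem_toFinset] at hg
    have hga : g ≠ a := fun h => hT'.1 (hTa T' hT'.2 (h ▸ hg))
    simp [hga]
  · refine ⟨fun g => if g = f then 1 else 0, by simp, ?_⟩
    refine Finset.sum_eq_zero fun T' hT' => ?_
    rw [Set.Finite.mem_toFinset] at hT'
    have h1 : 1 < (E \ T').ncard := by
      have h0 := (Set.ncard_pos hE.sdiff).2 ⟨a, ha⟩
      rw [hT'.ncard_sdiff_eq hE hT]
      omega
    obtain ⟨g, hg, hgf⟩ := Set.exists_ne_of_one_lt_ncard h1 f
    exact Finset.prod_eq_zero ((Set.Finite.mem_toFinset _).2 hg) (if_neg hgf)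

theorem finsum_isBasisOn_notMem {v : β → M} {w : β → M'} {E : Set β} {e : β} (hE : E.Finite)
    (he : e ∈ E) (h : ∀ T, e ∉ T → (IsBasisOn K v E T ↔ IsBasisOn K w (E \ {e}) T)) :
    ∑ᶠ (T : Set β) (_ : T ∈ {T | IsBasisOn K v E T ∧ e ∉ T}), ∏ᶠ (g : β) (_ : g ∈ E \ T),
      (X g : MvPolynomial β k) = X e * configPoly K k w (E \ {e}) := by
  have hset : {T | IsBasisOn K v E T ∧ e ∉ T} = {T | IsBasisOn K w (E \ {e}) T} := by
    ext T
    refine ⟨fun hT => (h T hT.2).1 hT.1, fun hT => ?_⟩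
    have heT : e ∉ T := fun h => (hT.1 h).2 rfl
    exact ⟨(h T heT).2 hT, heT⟩
  have hfin := finite_setOf_isBasisOn (K := K) w (hE.sdiff (t := {e}))
  rw [hset, configPoly]
  change _ = X e * ∑ᶠ (T : Set β) (_ : T ∈ {T | IsBasisOn K w (E \ {e}) T}), _
  rw [mul_finsum_mem' _ _ hfin]
  refine finsum_mem_congr rfl fun T hT => ?_
  have heT : e ∉ T := fun h => (hT.1 h).2 rfl
  have h1 : E \ T = insert e ((E \ {e}) \ T) := by
    ext g
    by_cases hge : g = e
    · subst hge; simp [he, heT]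
    · simp [hge]
  rw [h1, finprod_mem_insert _ (by simp) hE.sdiff.sdiff]

theorem finsum_isBasisOn_mem {v : β → M} {w : β → M'} {E : Set β} {e : β}
    (h : ∀ T, e ∉ T → (IsBasisOn K v E (insert e T) ↔ IsBasisOn K w (E \ {e}) T)) :
    ∑ᶠ (T : Set β) (_ : T ∈ {T | IsBasisOn K v E T ∧ e ∈ T}), ∏ᶠ (g : β) (_ : g ∈ E \ T),
      (X g : MvPolynomial β k) = configPoly K k w (E \ {e}) := by
  have hnot : ∀ T, IsBasisOn K w (E \ {e}) T → e ∉ T := fun T hT h => (hT.1 h).2 rfl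
  have hset : {T | IsBasisOn K v E T ∧ e ∈ T} = insert e '' {T | IsBasisOn K w (E \ {e}) T} := by
    ext T
    constructor
    · rintro ⟨hT, heT⟩
      refine ⟨T \ {e}, (h _ (by simp)).1 ?_, ?_⟩ <;>
      simp [Set.insert_eq_of_mem heT, hT]
    · rintro ⟨T', hT', rfl⟩
      exact ⟨(h T' (hnot _ hT')).2 hT', Set.mem_insert _ _⟩
  have hinj : Set.InjOn (insert e) {T | IsBasisOn K w (E \ {e}) T} := by
    intro T hT T' hT' hTT'
    rw [← Set.insert_sdiff_self_of_notMem (hnot T hT), hTT',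
      Set.insert_sdiff_self_of_notMem (hnot T' hT')]
  rw [hset, finsum_mem_image hinj, configPoly]
  refine finsum_mem_congr rfl fun T hT => ?_
  rw [Set.sdiff_sdiff, Set.singleton_union]

theorem configPoly_eq_add (v : β → M) {E : Set β} (hE : E.Finite) (e : β) :
    configPoly K k v E =
      ∑ᶠ (T : Set β) (_ : T ∈ {T | IsBasisOn K v E T ∧ e ∉ T}), ∏ᶠ (g : β) (_ : g ∈ E \ T), X g +
      ∑ᶠ (T : Set β) (_ : T ∈ {T | IsBasisOn K v E T ∧ e ∈ T}),
        ∏ᶠ (g : β) (_ : g ∈ E \ T), X g := by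
  have hfin := finite_setOf_isBasisOn (K := K) v hE
  rw [← finsum_mem_union _ (hfin.subset fun T h => h.1) (hfin.subset fun T h => h.1)]
  · refine finsum_mem_congr ?_ fun _ _ => rfl
    ext T
    simp only [Set.mem_union, Set.mem_ofPred_eq]
    tauto
  · exact Set.disjoint_left.2 fun T h h' => h.2 h'.2

theorem configPoly_eq_X_mul_of_eq_zero {v : β → M} {E : Set β} (hE : E.Finite) {e : β}
    (he : e ∈ E) (hv : v e = 0) :
    configPoly K k v E = X e * configPoly K k v (E \ {e}) := by
  rw [configPoly_eq_add v hE e, finsum_isBasisOn_notMem hE he (w := v) fun T heT =>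
    isBasisOn_sdiff_iff_of_mem_span (hv ▸ zero_mem _) heT]
  have : {T | IsBasisOn K v E T ∧ e ∈ T} = ∅ := by
    ext T
    simp only [Set.mem_ofPred_eq, Set.mem_empty_iff_false, iff_false, not_and]
    exact fun hT heT => hT.2.1.ne_zero heT hv
  rw [this, finsum_mem_empty, add_zero]

theorem configPoly_eq_of_notMem_span {v : β → M} {E : Set β} (hE : E.Finite) {e : β}
    (he : e ∈ E) (hv : v e ∉ Submodule.span K (v '' (E \ {e}))) :
    configPoly K k v E = configPoly K k v (E \ {e}) := by
  rw [configPoly_eq_add v hE e, finsum_isBasisOn_mem (w := v) fun T heT =>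
    isBasisOn_insert_iff_of_notMem_span he hv heT]
  have : {T | IsBasisOn K v E T ∧ e ∉ T} = ∅ := by
    ext T
    simp only [Set.mem_ofPred_eq, Set.mem_empty_iff_false, iff_false, not_and, not_not]
    intro hT
    by_contra heT
    refine hv (Submodule.span_mono (Set.image_mono ?_) (hT.2.2 ⟨e, he, rfl⟩))
    exact fun g hg => ⟨hT.1 hg, fun h => heT (h ▸ hg)⟩
  rw [this, finsum_mem_empty, zero_add]

/-- The deletion-contraction formula, for `e` neither a loop nor a bridge. -/
theorem configPoly_eq_X_mul_add {v : β → M} {E : Set β} (hE : E.Finite) {e : β}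
    (he : e ∈ E) (hv : v e ≠ 0) (hs : v e ∈ Submodule.span K (v '' (E \ {e})))
    (π : M →ₗ[K] M') (hπ : LinearMap.ker π = Submodule.span K {v e}) :
    configPoly K k v E = X e * configPoly K k v (E \ {e}) + configPoly K k (π ∘ v) (E \ {e}) := by
  rw [configPoly_eq_add v hE e, finsum_isBasisOn_notMem hE he (w := v) fun T heT =>
    isBasisOn_sdiff_iff_of_mem_span hs heT, finsum_isBasisOn_mem (w := π ∘ v) fun T heT =>
    isBasisOn_insert_iff_of_ker he hv π hπ heT]

theorem configPoly_union {v : β → M} {E₁ E₂ : Set β} (hE₁ : E₁.Finite) (hE₂ : E₂.Finite)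
    (hE : Disjoint E₁ E₂)
    (hd : Disjoint (Submodule.span K (v '' E₁)) (Submodule.span K (v '' E₂))) :
    configPoly K k v (E₁ ∪ E₂) = configPoly K k v E₁ * configPoly K k v E₂ := by
  classical
  rw [configPoly_eq_sum v (hE₁.union hE₂), configPoly_eq_sum v hE₁, configPoly_eq_sum v hE₂,
    Finset.sum_mul_sum, ← Finset.sum_product']
  have hcap : ∀ p : Set β × Set β, p.1 ⊆ E₁ → p.2 ⊆ E₂ →
      (p.1 ∪ p.2) ∩ E₁ = p.1 ∧ (p.1 ∪ p.2) ∩ E₂ = p.2 := by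
    intro p h₁ h₂
    constructor
    · rw [Set.union_inter_distrib_right, Set.inter_eq_left.2 h₁,
        (hE.mono_right h₂).symm.inter_eq, Set.union_empty]
    · rw [Set.union_inter_distrib_right, Set.inter_eq_left.2 h₂,
        (hE.mono_left h₁).inter_eq, Set.empty_union]
  refine Finset.sum_bij' (fun T _ => (T ∩ E₁, T ∩ E₂)) (fun p _ => p.1 ∪ p.2) ?_ ?_ ?_ ?_ ?_
  · intro T hT
    rw [Set.Finite.mem_toFinset] at hT
    simpa using (isBasisOn_union_iff hd hT.1).1 hT
  · rintro p hp
    simp only [Finset.mem_product, Set.Finite.mem_toFinset, Set.mem_ofPred_eq] at hp ⊢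
    obtain ⟨h₁, h₂⟩ := hcap p hp.1.1 hp.2.1
    rw [isBasisOn_union_iff hd (Set.union_subset_union hp.1.1 hp.2.1), h₁, h₂]
    exact hp
  · intro T hT
    rw [Set.Finite.mem_toFinset] at hT
    rw [← Set.inter_union_distrib_left, Set.inter_eq_left.2 hT.1]
  · rintro p hp
    simp only [Finset.mem_product, Set.Finite.mem_toFinset, Set.mem_ofPred_eq] at hp
    obtain ⟨h₁, h₂⟩ := hcap p hp.1.1 hp.2.1
    exact Prod.ext h₁ h₂
  · intro T hT
    rw [← Finset.prod_union]
    · refine Finset.prod_congr ?_ fun _ _ => rfl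
      ext g
      simp only [Set.Finite.mem_toFinset, Finset.mem_union, Set.mem_sdiff, Set.mem_union,
        Set.mem_inter_iff]
      tauto
    · rw [Finset.disjoint_left]
      intro g h₁ h₂
      rw [Set.Finite.mem_toFinset] at h₁ h₂
      exact Set.disjoint_left.1 hE h₁.1 h₂.1

end Configurations

/-! ### The vector configuration of a graph -/

section GraphVectors

variable {α β γ : Type*}

open Classical in
/-- The vector of an edge of `G`: the sum, modulo `2`, of its two ends (so that it is zero for a
loop). It is `0` if `g` is not an edge of `G`. -/
noncomputable def edgeVec (G : Graph α β) (g : β) : α →₀ ZMod 2 :=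
  if h : ∃ p : α × α, G.IsLink g p.1 p.2 then
    Finsupp.single h.choose.1 1 + Finsupp.single h.choose.2 1 else 0

theorem edgeVec_of_isLink {G : Graph α β} {g : β} {x y : α} (h : G.IsLink g x y) :
    edgeVec G g = Finsupp.single x 1 + Finsupp.single y 1 := by
  have h' : ∃ p : α × α, G.IsLink g p.1 p.2 := ⟨(x, y), h⟩
  rw [edgeVec, dif_pos h']
  rcases h'.choose_spec.eq_and_eq_or_eq_and_eq h with ⟨h1, h2⟩ | ⟨h1, h2⟩
  · rw [h1, h2]
  · rw [h1, h2, add_comm]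

theorem edgeVec_eq_of_le {G H : Graph α β} (h : H ≤ G) {g : β} (hg : g ∈ H.edgeSet) :
    edgeVec H g = edgeVec G g := by
  obtain ⟨x, y, hxy⟩ := H.exists_isLink_of_mem_edgeSet hg
  rw [edgeVec_of_isLink hxy, edgeVec_of_isLink (hxy.mono h)]

/-- For the direct implication, the indicator function of the component of `x` is a linear form that
vanishes on all edges. -/
theorem single_add_single_mem_span_iff (G : Graph α β) (x y : α) :
    Finsupp.single x (1 : ZMod 2) + Finsupp.single y 1 ∈
      Submodule.span (ZMod 2) (edgeVec G '' G.edgeSet) ↔ Relation.ReflTransGen G.Adj x y := by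
  classical
  constructor
  · intro h
    let φ : (α →₀ ZMod 2) →ₗ[ZMod 2] ZMod 2 :=
      Finsupp.linearCombination (ZMod 2) fun z => if Relation.ReflTransGen G.Adj x z then 1 else 0
    have hφ : Submodule.span (ZMod 2) (edgeVec G '' G.edgeSet) ≤ LinearMap.ker φ := by
      rw [Submodule.span_le]
      rintro _ ⟨g, hg, rfl⟩
      obtain ⟨u, w, huw⟩ := G.exists_isLink_of_mem_edgeSet hg
      have huw' : Relation.ReflTransGen G.Adj x u ↔ Relation.ReflTransGen G.Adj x w :=
        ⟨fun h => h.tail huw.adj, fun h => h.tail huw.adj.symm⟩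
      rw [edgeVec_of_isLink huw, SetLike.mem_coe, LinearMap.mem_ker, map_add]
      simp only [φ, Finsupp.linearCombination_single, one_smul, huw']
      exact CharTwo.add_self_eq_zero _
    have h1 := hφ h
    by_contra hxy
    rw [LinearMap.mem_ker, map_add] at h1
    simp [φ, hxy, Relation.ReflTransGen.refl] at h1
  · intro h
    induction h with
    | refl =>
      rw [ZModModule.add_self]
      exact zero_mem _
    | @tail u w _ huw ih =>
      obtain ⟨g, hg⟩ := huw
      have h1 := add_mem ih (Submodule.subset_span (R := ZMod 2)
        (Set.mem_image_of_mem (edgeVec G) hg.edge_mem))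
      rw [edgeVec_of_isLink hg] at h1
      convert h1 using 1
      have : Finsupp.single u (1 : ZMod 2) + Finsupp.single u 1 = 0 := ZModModule.add_self _
      rw [add_assoc, ← add_assoc (Finsupp.single u 1), this, zero_add]

theorem isForest_iff_linearIndepOn (G : Graph α β) :
    IsForest G ↔ LinearIndepOn (ZMod 2) (edgeVec G) G.edgeSet := by
  rw [linearIndepOn_iff_notMem_span]
  have key : ∀ g x y, G.IsLink g x y → (edgeVec G g ∈ Submodule.span (ZMod 2)
      (edgeVec G '' (G.edgeSet \ {g})) ↔ Relation.ReflTransGen (G.deleteEdges {g}).Adj x y) := by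
    intro g x y h
    rw [edgeVec_of_isLink h, ← single_add_single_mem_span_iff]
    have : Set.EqOn (edgeVec (G.deleteEdges {g})) (edgeVec G) (G.edgeSet \ {g}) := fun g' hg' =>
      edgeVec_eq_of_le Graph.deleteEdges_le (by simpa using hg')
    rw [← this.image_eq, Graph.edgeSet_deleteEdges]
  constructor
  · intro h g hg
    obtain ⟨x, y, hxy⟩ := G.exists_isLink_of_mem_edgeSet hg
    rw [key g x y hxy]
    exact h g x y hxy
  · intro h g x y hxy
    rw [← key g x y hxy]
    exact h g hxy.edge_mem

theorem isMaxSpanningForest_iff (G : Graph α β) (T : Set β) :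
    IsMaxSpanningForest G T ↔ IsBasisOn (ZMod 2) (edgeVec G) G.edgeSet T := by
  rw [← maximal_linearIndepOn_iff, IsMaxSpanningForest]
  have : ∀ S : Set β, (S ⊆ G.edgeSet ∧ IsForest (G.restrict S)) ↔
      (S ⊆ G.edgeSet ∧ LinearIndepOn (ZMod 2) (edgeVec G) S) := by
    intro S
    refine and_congr_right fun hS => ?_
    rw [isForest_iff_linearIndepOn, Graph.edgeSet_restrict, Set.inter_eq_right.2 hS]
    refine linearIndepOn_congr fun g hg => edgeVec_eq_of_le Graph.restrict_le ?_
    exact ⟨hS hg, hg⟩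
  simp only [this]

theorem graphPoly_eq_configPoly (k : Type*) [Field k] (G : Graph α β) :
    graphPoly k G = configPoly (ZMod 2) k (edgeVec G) G.edgeSet := by
  simp only [graphPoly, configPoly, isMaxSpanningForest_iff]

theorem graphPoly_eq_configPoly_of_le (k : Type*) [Field k] {G H : Graph α β} (h : H ≤ G) :
    graphPoly k H = configPoly (ZMod 2) k (edgeVec G) H.edgeSet := by
  rw [graphPoly_eq_configPoly]
  exact configPoly_congr fun g hg => edgeVec_eq_of_le h hg

theorem ker_lmapDomain_le {R : Type*} [Ring R] (c : α → γ) (N : Submodule R (α →₀ R))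
    (h : ∀ z z', c z = c z' → Finsupp.single z 1 - Finsupp.single z' 1 ∈ N) :
    LinearMap.ker (Finsupp.lmapDomain R R c) ≤ N := by
  intro m hm
  rcases isEmpty_or_nonempty α with hα | hα
  · rw [Subsingleton.elim m 0]
    exact zero_mem _
  have h1 : N.mkQ ∘ₗ Finsupp.lmapDomain R R (Function.invFun c) ∘ₗ Finsupp.lmapDomain R R c =
      N.mkQ := by
    refine Finsupp.lhom_ext' fun z => LinearMap.ext_ring ?_
    simp only [LinearMap.comp_apply, Finsupp.lsingle_apply, Finsupp.lmapDomain_apply,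
      Finsupp.mapDomain_single]
    exact (Submodule.Quotient.eq N).2 (h _ _ (Function.invFun_eq ⟨z, rfl⟩))
  have h2 := LinearMap.congr_fun h1 m
  rw [LinearMap.comp_apply, LinearMap.comp_apply, LinearMap.mem_ker.1 hm, map_zero, map_zero] at h2
  exact (Submodule.Quotient.mk_eq_zero N).1 h2.symm

/-- The identification of vertices that defines `G / e`. -/
def contractionMap (G : Graph α β) (e : β) (z : α) : Set α :=
  {w | w = z ∨ (G.Inc e z ∧ G.Inc e w)}

theorem ker_lmapDomain_contractionMap (G : Graph α β) {e : β} (he : e ∈ G.edgeSet) :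
    LinearMap.ker (Finsupp.lmapDomain (ZMod 2) (ZMod 2) (contractionMap G e)) =
      Submodule.span (ZMod 2) {edgeVec G e} := by
  obtain ⟨x, y, hxy⟩ := G.exists_isLink_of_mem_edgeSet he
  refine le_antisymm (ker_lmapDomain_le _ _ fun z z' hz => ?_) ?_
  · have h1 : z ∈ contractionMap G e z' := hz ▸ Or.inl rfl
    rcases h1 with rfl | ⟨hz', hz⟩
    · rw [sub_self]; exact zero_mem _
    · obtain ⟨w, hw⟩ := hz'
      have hww : z = z' ∨ z = w := hz.eq_or_eq_of_isLink hw
      rcases hww with rfl | rfl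
      · rw [sub_self]; exact zero_mem _
      · rw [ZModModule.sub_eq_add, add_comm, edgeVec_of_isLink hw]
        exact Submodule.mem_span_singleton_self _
  · rw [Submodule.span_singleton_le_iff_mem, LinearMap.mem_ker, edgeVec_of_isLink hxy, map_add,
      Finsupp.lmapDomain_apply, Finsupp.lmapDomain_apply, Finsupp.mapDomain_single,
      Finsupp.mapDomain_single]
    have : contractionMap G e x = contractionMap G e y := by
      ext w
      have hx := hxy.inc_left
      have hy := hxy.inc_right
      simp only [contractionMap, Set.mem_ofPred_eq, hx, hy, true_and]
      constructor
      · rintro (rfl | h)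
        exacts [Or.inr hx, Or.inr h]
      · rintro (rfl | h)
        exacts [Or.inr hy, Or.inr h]
    rw [this]
    exact ZModModule.add_self _

theorem graphPoly_contraction (k : Type*) [Field k] (G : Graph α β) (e : β) :
    graphPoly k (contraction G e) = configPoly (ZMod 2) k
      (Finsupp.lmapDomain (ZMod 2) (ZMod 2) (contractionMap G e) ∘ edgeVec G)
      (G.edgeSet \ {e}) := by
  rw [graphPoly_eq_configPoly]
  have h1 : (contraction G e).edgeSet = G.edgeSet \ {e} := by simp [contraction]
  rw [h1]
  refine configPoly_congr fun g hg => ?_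
  obtain ⟨x, y, hxy⟩ := G.exists_isLink_of_mem_edgeSet hg.1
  have h2 : (contraction G e).IsLink g (contractionMap G e x) (contractionMap G e y) :=
    Graph.IsLink.map _ (by simpa [hxy] using hg.2)
  rw [edgeVec_of_isLink h2, Function.comp_apply, edgeVec_of_isLink hxy, map_add,
    Finsupp.lmapDomain_apply, Finsupp.lmapDomain_apply, Finsupp.mapDomain_single,
    Finsupp.mapDomain_single]

/-- A vector in both spans is supported at the common vertex and has coordinates of sum zero. -/
theorem disjoint_span_edgeVec {G G₁ G₂ : Graph α β} (h₁ : G₁ ≤ G) (h₂ : G₂ ≤ G) {v : α}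
    (hv : G₁.vertexSet ∩ G₂.vertexSet = {v}) :
    Disjoint (Submodule.span (ZMod 2) (edgeVec G '' G₁.edgeSet))
      (Submodule.span (ZMod 2) (edgeVec G '' G₂.edgeSet)) := by
  have hsupp : ∀ H ≤ G, Submodule.span (ZMod 2) (edgeVec G '' H.edgeSet) ≤
      Finsupp.supported (ZMod 2) (ZMod 2) H.vertexSet ⊓
        LinearMap.ker (Finsupp.linearCombination (ZMod 2) fun _ : α => (1 : ZMod 2)) := by
    intro H hH
    rw [Submodule.span_le]
    rintro _ ⟨g, hg, rfl⟩
    obtain ⟨x, y, hxy⟩ := H.exists_isLink_of_mem_edgeSet hg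
    rw [edgeVec_of_isLink (hxy.mono hH)]
    refine ⟨add_mem (Finsupp.single_mem_supported _ _ hxy.left_mem)
      (Finsupp.single_mem_supported _ _ hxy.right_mem), ?_⟩
    rw [SetLike.mem_coe, LinearMap.mem_ker, map_add, Finsupp.linearCombination_single,
      Finsupp.linearCombination_single]
    exact CharTwo.add_self_eq_zero _
  rw [Submodule.disjoint_def]
  intro m hm₁ hm₂
  obtain ⟨hs₁, hk⟩ := hsupp G₁ h₁ hm₁
  obtain ⟨hs₂, -⟩ := hsupp G₂ h₂ hm₂
  have hs : ↑m.support ⊆ ({v} : Set α) := hv ▸ Set.subset_inter hs₁ hs₂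
  have hm : m = Finsupp.single v (m v) := by
    ext z
    by_cases hz : z = v
    · subst hz; simp
    · rw [Finsupp.single_eq_of_ne hz]
      by_contra hne
      exact hz (hs (Finsupp.mem_support_iff.2 hne))
  rw [hm, SetLike.mem_coe, LinearMap.mem_ker, Finsupp.linearCombination_single, smul_eq_mul,
    mul_one] at hk
  rw [hm, hk, Finsupp.single_zero]

theorem ne_edgeSet_of_not_isForest {G H : Graph α β} (h : H ≤ G) (hH : ¬ IsForest H) {T : Set β}
    (hT : IsBasisOn (ZMod 2) (edgeVec G) H.edgeSet T) : T ≠ H.edgeSet := by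
  rintro rfl
  refine hH ((isForest_iff_linearIndepOn H).2 (hT.2.1.congr fun g hg => ?_))
  exact (edgeVec_eq_of_le h hg).symm

end GraphVectors

/-! ### Graph hypersurfaces with a disjoinable deletion -/

section Assembly

variable {β : Type*} {k : Type*} [Field k]

theorem exists_rename_eq_of_mem_supported {s t : Set β} (hst : s ⊆ t) {p : MvPolynomial β k}
    (hp : p ∈ supported k s) : ∃ p' : MvPolynomial t k, rename Subtype.val p' = p := by
  have h := supported_mono hst hp
  rw [supported_eq_range_rename] at h
  exact h

theorem eval_eq_of_mem_supported {s : Set β} {p : MvPolynomial β k} (hp : p ∈ supported k s)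
    {z w : β → k} (h : Set.EqOn z w s) : eval z p = eval w p := by
  refine eval₂Hom_congr' rfl (fun i hi _ => ?_) rfl
  exact h (mem_supported.1 hp hi)

theorem exists_common_zero {p₁ p₂ : MvPolynomial β k} {E₁ E₂ : Set β} (hE : Disjoint E₁ E₂)
    (hp₁ : p₁ ∈ supported k E₁) (hp₂ : p₂ ∈ supported k E₂) {f : β}
    (h₁ : ∃ z : β → k, z f = 1 ∧ eval z p₁ = 0) (h₂ : ∃ z : β → k, z f = 1 ∧ eval z p₂ = 0) :
    ∃ z : β → k, z f = 1 ∧ eval z p₁ = 0 ∧ eval z p₂ = 0 := by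
  classical
  obtain ⟨z₁, hf₁, hz₁⟩ := h₁
  obtain ⟨z₂, hf₂, hz₂⟩ := h₂
  refine ⟨fun g => if g ∈ E₁ then z₁ g else z₂ g, by simp [hf₁, hf₂], ?_, ?_⟩
  · rw [← hz₁]
    exact eval_eq_of_mem_supported hp₁ fun g hg => if_pos hg
  · rw [← hz₂]
    exact eval_eq_of_mem_supported hp₂ fun g hg => if_neg (Set.disjoint_right.1 hE hg)

theorem NonsingularInCodimOne.false_of_exists_prime {α : Type*} (Γ : Graph α β) (e : β)
    (hX : NonsingularInCodimOne k Γ) (he : e ∈ Γ.edgeSet)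
    {h : MvPolynomial ↥(Γ.edgeSet \ {e}) k} (heq : chartEquation k Γ e = h)
    (H : ∃ (p : Ideal (MvPolynomial ↥(Γ.edgeSet \ {e}) k ⧸ Ideal.span {h})) (_ : p.IsPrime),
      p.height ≤ 1 ∧ ¬ IsRegularLocalRing (Localization.AtPrime p)) : False := by
  subst heq
  obtain ⟨p, hp, h1, h2⟩ := H
  exact h2 (hX e he p h1)

theorem chartEquation_eq {α : Type*} (Γ : Graph α β) (e : β)
    {p q : MvPolynomial ↥(Γ.edgeSet \ {e}) k} {m : ℕ}
    (h : graphPoly k Γ = X e ^ m * rename Subtype.val p + rename Subtype.val q) :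
    chartEquation k Γ e = p + q := by
  classical
  rw [chartEquation, h, map_add, map_mul, map_pow, aeval_X, aeval_rename, aeval_rename,
    dif_neg (by simp), one_pow, one_mul]
  have : ((fun g : β => if h : g ∈ Γ.edgeSet \ {e} then
      (X ⟨g, h⟩ : MvPolynomial ↥(Γ.edgeSet \ {e}) k) else 1) ∘ Subtype.val) = X := by
    ext1 g
    simp only [Function.comp_apply, dif_pos g.2]
  rw [this, aeval_X_left_apply, aeval_X_left_apply]

theorem blowupPullback_eq {α : Type*} (Γ : Graph α β) (e : β) (f : ↥(Γ.edgeSet \ {e}))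
    {p q : MvPolynomial ↥(Γ.edgeSet \ {e}) k}
    (h : graphPoly k Γ = X e * rename Subtype.val p + rename Subtype.val q) :
    blowupPullback k Γ e f = blowupChart f (p + q) := by
  classical
  rw [blowupPullback, h, map_add, map_mul, aeval_X, aeval_rename, aeval_rename,
    dif_neg (by simp), one_mul, map_add]
  have : ((fun g : β => if h : g ∈ Γ.edgeSet \ {e} then
      (if g = f then X f else X f * X ⟨g, h⟩ : MvPolynomial ↥(Γ.edgeSet \ {e}) k) else 1) ∘
        Subtype.val) = fun g => if g = f then X f else X f * X g := by
    ext1 g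
    simp only [Function.comp_apply, dif_pos g.2, Subtype.coe_inj]
  rw [blowupChart, this]
  congr!

theorem not_conditionI_or_not_conditionII [CharZero k] {α : Type*} (Γ : Graph α β)
    (hE : Γ.edgeSet.Finite) (e : β) (he : e ∈ Γ.edgeSet) (hX : NonsingularInCodimOne k Γ)
    (hd : IsDisjoinable (deletion Γ e)) (hI : ConditionI k Γ e) (hII : ConditionII k Γ e) :
    False := by
  classical
  obtain ⟨G₁, G₂, v, hG₁, hG₂, -, hV, hEu, hEi, hF₁, hF₂⟩ := hd
  have hle : deletion Γ e ≤ Γ := Graph.deleteEdges_le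
  have hED : (deletion Γ e).edgeSet = Γ.edgeSet \ {e} := by simp [deletion]
  rw [hED] at hEu
  have hfin : (Γ.edgeSet \ {e}).Finite := hE.sdiff
  have : Finite ↥(Γ.edgeSet \ {e}) := hfin
  have hs₁ : G₁.edgeSet ⊆ Γ.edgeSet \ {e} := hEu ▸ Set.subset_union_left
  have hs₂ : G₂.edgeSet ⊆ Γ.edgeSet \ {e} := hEu ▸ Set.subset_union_right
  have hfin₁ := hfin.subset hs₁
  have hfin₂ := hfin.subset hs₂
  have hdE : Disjoint G₁.edgeSet G₂.edgeSet := Set.disjoint_iff_inter_eq_empty.2 hEi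
  have hds := disjoint_span_edgeVec (hG₁.trans hle) (hG₂.trans hle) hV
  set w := edgeVec Γ with hw
  have hprod : configPoly (ZMod 2) k w (Γ.edgeSet \ {e}) =
      configPoly (ZMod 2) k w G₁.edgeSet * configPoly (ZMod 2) k w G₂.edgeSet := by
    rw [← hEu]
    exact configPoly_union hfin₁ hfin₂ hdE hds
  have hsup₁ := configPoly_mem_supported (K := ZMod 2) (k := k) w hfin₁
  have hsup₂ := configPoly_mem_supported (K := ZMod 2) (k := k) w hfin₂
  obtain ⟨p₁, hp₁⟩ := exists_rename_eq_of_mem_supported hs₁ hsup₁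
  obtain ⟨p₂, hp₂⟩ := exists_rename_eq_of_mem_supported hs₂ hsup₂
  have hprod' : configPoly (ZMod 2) k w (Γ.edgeSet \ {e}) = rename Subtype.val (p₁ * p₂) := by
    rw [hprod, map_mul, hp₁, hp₂]
  have hinj : Function.Injective (Subtype.val : ↥(Γ.edgeSet \ {e}) → β) := Subtype.val_injective
  have hone : eval (fun _ => 1) (p₁ * p₂) ≠ 0 := by
    have h1 := eval_one_configPoly_ne_zero (K := ZMod 2) (k := k) w hfin
    rw [hprod', eval_rename] at h1
    exact h1
  obtain ⟨T, hT⟩ := exists_isBasisOn (K := ZMod 2) w (Γ.edgeSet \ {e})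
  have hT' := hT
  rw [← hEu] at hT'
  obtain ⟨hT₁, hT₂⟩ := (isBasisOn_union_iff hds hT'.1).1 hT'
  have hzero : ∀ f, f ∉ (Γ.edgeSet \ {e}) \ T →
      ∃ z : β → k, z f = 1 ∧ eval (z ∘ Subtype.val) p₁ = 0 ∧ eval (z ∘ Subtype.val) p₂ = 0 := by
    intro f hf
    have h1 := exists_eval_configPoly_eq_zero (k := k) hfin₁ hT₁
      (ne_edgeSet_of_not_isForest (hG₁.trans hle) hF₁ hT₁) (f := f)
      fun h => hf ⟨hs₁ h.1, fun hfT => h.2 ⟨hfT, h.1⟩⟩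
    have h2 := exists_eval_configPoly_eq_zero (k := k) hfin₂ hT₂
      (ne_edgeSet_of_not_isForest (hG₂.trans hle) hF₂ hT₂) (f := f)
      fun h => hf ⟨hs₂ h.1, fun hfT => h.2 ⟨hfT, h.1⟩⟩
    obtain ⟨z, hz, hz₁, hz₂⟩ := exists_common_zero hdE hsup₁ hsup₂ h1 h2
    refine ⟨z, hz, ?_, ?_⟩
    · rwa [← hp₁, eval_rename] at hz₁
    · rwa [← hp₂, eval_rename] at hz₂
  have hgraph : graphPoly k Γ = configPoly (ZMod 2) k w Γ.edgeSet := graphPoly_eq_configPoly k Γ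
  -- if `e` is a loop or a bridge, the chart `t_e = 1` of the hypersurface is reducible
  have hred : ∀ m : ℕ, graphPoly k Γ ≠ X e ^ m * rename Subtype.val (p₁ * p₂) := by
    intro m hm
    have h1 : chartEquation k Γ e = p₁ * p₂ := by
      have := chartEquation_eq Γ e (p := p₁ * p₂) (q := 0) (m := m) (by rw [hm, map_zero, add_zero])
      rwa [add_zero] at this
    obtain ⟨z, -, hz₁, hz₂⟩ := hzero e (by simp)
    exact hX.false_of_exists_prime Γ e he h1
      (exists_prime_not_isRegularLocalRing_of_mul (fun h => hone (by rw [h, map_zero])) _ hz₁ hz₂)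
  have hloop : w e ≠ 0 := by
    intro h0
    apply hred 1
    rw [hgraph, configPoly_eq_X_mul_of_eq_zero hE he h0, hprod', pow_one]
  have hbridge : w e ∈ Submodule.span (ZMod 2) (w '' (Γ.edgeSet \ {e})) := by
    by_contra h0
    apply hred 0
    rw [hgraph, configPoly_eq_of_notMem_span hE he h0, hprod', pow_zero, one_mul]
  let π := Finsupp.lmapDomain (ZMod 2) (ZMod 2) (contractionMap Γ e)
  have hπ : LinearMap.ker π = Submodule.span (ZMod 2) {w e} := ker_lmapDomain_contractionMap Γ he
  have hsup := configPoly_mem_supported (K := ZMod 2) (k := k) (π ∘ w) hfin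
  obtain ⟨q, hq⟩ := exists_rename_eq_of_mem_supported subset_rfl hsup
  have hsplit : graphPoly k Γ = X e * rename Subtype.val (p₁ * p₂) + rename Subtype.val q := by
    rw [hgraph, configPoly_eq_X_mul_add hE he hloop hbridge π hπ, hprod', hq]
  -- the contraction has degree one more than the deletion, since a basis of it has one edge less
  obtain ⟨S, hS⟩ := exists_isBasisOn (K := ZMod 2) (π ∘ w) (Γ.edgeSet \ {e})
  have heS : e ∉ S := fun h => (hS.1 h).2 rfl
  have heT : e ∉ T := fun h => (hT.1 h).2 rfl
  have hdeg : ((Γ.edgeSet \ {e}) \ S).ncard = ((Γ.edgeSet \ {e}) \ T).ncard + 1 := by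
    have h1 := ((isBasisOn_insert_iff_of_ker he hloop π hπ heS).2 hS).ncard_sdiff_eq hE
      ((isBasisOn_sdiff_iff_of_mem_span hbridge heT).2 hT)
    have h2 : Γ.edgeSet \ insert e S = (Γ.edgeSet \ {e}) \ S := by
      rw [Set.sdiff_sdiff, Set.singleton_union]
    have h3 : Γ.edgeSet \ T = insert e ((Γ.edgeSet \ {e}) \ T) := by
      ext g
      by_cases hge : g = e
      · subst hge; simp [he, heT]
      · simp [hge]
    rw [h2, h3, Set.ncard_insert_of_notMem (by simp) hfin.sdiff] at h1
    exact h1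
  have hhomF : (p₁ * p₂).IsHomogeneous ((Γ.edgeSet \ {e}) \ T).ncard := by
    have h1 := isHomogeneous_configPoly (k := k) hfin hT
    rwa [hprod', IsHomogeneous.rename_isHomogeneous_iff hinj] at h1
  have hhomG : q.IsHomogeneous (((Γ.edgeSet \ {e}) \ T).ncard + 1) := by
    have h1 := isHomogeneous_configPoly (k := k) hfin hS
    rwa [← hq, IsHomogeneous.rename_isHomogeneous_iff hinj, hdeg] at h1
  have hmem : q ∈ Ideal.span {p₁, p₂} := by
    have h1 := hI
    rw [ConditionI, graphPoly_contraction, graphPoly_eq_configPoly_of_le k hle, hED, hprod',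
      killCompl_rename_app] at h1
    change killCompl _ (configPoly (ZMod 2) k (π ∘ w) (Γ.edgeSet \ {e})) ∈ _ at h1
    rw [← hq, killCompl_rename_app] at h1
    refine Ideal.span_le.2 ?_ h1
    rintro _ ⟨i, rfl⟩
    simp only [pderiv_mul]
    exact add_mem (Ideal.mul_mem_left _ _ (Ideal.subset_span (by simp)))
      (Ideal.mul_mem_right _ _ (Ideal.subset_span (by simp)))
  -- the deletion has a nonempty maximal forest `T`, as it joins the distinct ends of `e`; an edge
  -- of `T` gives a chart that contains a zero of `p₁` and `p₂`
  obtain ⟨f, hfT⟩ : T.Nonempty := by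
    rw [Set.nonempty_iff_ne_empty]
    rintro rfl
    rw [← hT.span_eq] at hbridge
    simp [hloop] at hbridge
  obtain ⟨z, hzf, hz₁, hz₂⟩ := hzero f fun h => h.2 hfT
  let f' : ↥(Γ.edgeSet \ {e}) := ⟨f, hT.1 hfT⟩
  refine hX.false_of_exists_prime Γ e he
    (chartEquation_eq Γ e (m := 1) (by rw [pow_one]; exact hsplit))
    (exists_prime_not_isRegularLocalRing_of_pow_cancel f' hhomF hhomG hmem hone
      (z ∘ Subtype.val) hzf hz₁ hz₂ (blowupIdeal k Γ e f') (fun r => ?_) (hII f'))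
  rw [← blowupPullback_eq Γ e f' hsplit]
  rfl

end Assembly

end GraphHypersurface

theorem mainTheorem8 {k : Type*} [Field k] [IsAlgClosed k] [CharZero k] {α β : Type*}
    (Γ : Graph α β) (hV : Γ.vertexSet.Finite) (hE : Γ.edgeSet.Finite)
    (e : β) (he : e ∈ Γ.edgeSet)
    (hX : GraphHypersurface.NonsingularInCodimOne k Γ)
    (hd : GraphHypersurface.IsDisjoinable (GraphHypersurface.deletion Γ e)) :
    ¬ GraphHypersurface.ConditionI k Γ e ∨ ¬ GraphHypersurface.ConditionII k Γ e := by
  by_contra! h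
  exact GraphHypersurface.not_conditionI_or_not_conditionII Γ hE e he hX hd h.1 h.2
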